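/- Let $K$ be a global field and let $X$ be an A-curve with field of functions $K$: either $X=\mathrm{Spec}(\mathcal O_{K,S})$ for a number field $K$ and a finite set $S$ of places containing the archimedean ones, or $X$ is a smooth curve, affine or projective, over a finite field. Let $\mathfrak A$ be a quaternion algebra over $K$, i.e. a central simple $K$-algebra of dimension $4$. An $X$-lattice of maximal rank in a finite-dimensional $K$-vector space $V$ is a locally free subsheaf of maximal rank of the constant sheaf $V$ on $X$; an $X$-order of maximal rank in $\mathfrak A$ is an $X$-lattice of maximal rank in $\mathfrak A$ that is a sheaf of unital subrings. A maximal order is an $X$-order of maximal rank that is not properly contained in another one; an Eichler order is the intersection of two (possibly equal) maximal orders; an integral ideal is an $X$-lattice of rank one in $K$ contained in $\mathcal O_X$. For a closed point $\wp$ of $X$ let $\mathfrak A_\wp=\mathfrak A\otimes_K K_\wp$, where $K_\wp$ is the completion of $K$ at $\wp$. Then, for every $X$-order $\mathfrak D$ of maximal rank in $\mathfrak A$, the following conditions are equivalent: 1. $\mathfrak D=\mathcal O_X+I\mathfrak D_0$ for an Eichler order $\mathfrak D_0$ in $\mathfrak A$ and an integral ideal $I$ such that $I_\wp=\mathcal O_\wp$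 at every closed point $\wp$ of $X$ for which $\mathfrak A_\wp$ is a division algebra. 2. $\mathfrak D$ is the intersection of a finite (non-empty) family of maximal orders. 3. $\mathfrak D$ is the intersection of three (not necessarily distinct) maximal orders. -/

import Mathlib

open scoped TensorProduct

/-- A field is a global field if it is a number field, or a finite extension of `𝔽_p(t)` for some
prime `p`. -/
def IsGlobalField (K : Type*) [Field K] : Prop :=
  NumberField K ∨
    ∃ (p : ℕ) (_ : Fact p.Prime) (_ : Algebra (RatFunc (ZMod p)) K), FunctionField (ZMod p) K

/-- A discrete valuation ring with field of fractions `K`. For a global field `K` these are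
exactly the valuation rings of the non-archimedean places of `K`. -/
@[ext]
structure DVRPlace (K : Type*) [Field K] where
  /-- the local ring `𝒪_{X,℘} ⊆ K` at the place -/
  ring : ValuationSubring K
  isDVR : IsDiscreteValuationRing ring

attribute [instance] DVRPlace.isDVR

/-- An A-curve `X` with field of functions the global field `K`, given by its set of closed points.
A closed point is identified with its local ring, a discrete valuation ring of `K`; the
closed points are all non-archimedean places of `K` outside a finite set. For a number field these
are the schemes `Spec 𝒪_{K,S}` with `S` finite and containing the archimedean places. For a global
function field they are the smooth curves over a finite field with function field `K`, affine
(finite non-empty complement) or projective (empty complement). -/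
structure ACurve (K : Type*) [Field K] where
  /-- the closed points -/
  points : Set (DVRPlace K)
  finite_compl : pointsᶜ.Finite

namespace ACurve

variable {K : Type*} [Field K]

/-- The local ring `𝒪_{X,℘} ⊆ K` of the curve at a closed point `℘`. -/
abbrev localRing (X : ACurve K) (p : X.points) : ValuationSubring K := p.1.ring

/-- The completion `K_℘` of `K` at a closed point `℘`. -/
abbrev Completion (X : ACurve K) (p : X.points) : Type _ :=
  (IsDiscreteValuationRing.maximalIdeal (X.localRing p)).adicCompletion K

/-- `A_℘ = A ⊗_K K_℘` is a division algebra. -/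
def IsDivisionAt (X : ACurve K) (A : Type*) [Ring A] [Algebra K A] (p : X.points) : Prop :=
  ∀ x : A ⊗[K] X.Completion p, x ≠ 0 → IsUnit x

/-- An `X`-lattice of maximal rank in a finite-dimensional `K`-vector space `V`: a locally free
subsheaf `Λ` of maximal rank of the constant sheaf `V` on `X`. It is given by its stalks: at each
closed point `℘` a finitely generated `𝒪_{X,℘}`-submodule `Λ_℘` of `V` that spans `V` over `K`,
such that the family is, outside finitely many points, generated by one and the same `K`-basis of
`V`. The sections over a non-empty open set `U` are `⋂_{℘ ∈ U} Λ_℘`. -/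
structure Lattice (X : ACurve K) (V : Type*) [AddCommGroup V] [Module K V] where
  /-- the stalk at a closed point -/
  stalk : ∀ p : X.points, Submodule (X.localRing p) V
  fg_stalk : ∀ p, (stalk p).FG
  span_stalk : ∀ p, Submodule.span K (stalk p : Set V) = ⊤
  coherent : ∃ (n : ℕ) (b : Module.Basis (Fin n) K V),
    {p : X.points | stalk p ≠ Submodule.span (X.localRing p) (Set.range b)}.Finite

/-- An integral ideal on `X`: a one-dimensional lattice `I` in `K` contained in `𝒪_X`. -/
structure IntegralIdeal (X : ACurve K) extends X.Lattice K where
  integral : ∀ p, stalk p ≤ 1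

/-- An `X`-order of maximal rank in the algebra `A`: an `X`-lattice of maximal rank in `A` that is
a sheaf of rings with the unit of `A`. -/
structure Order (X : ACurve K) (A : Type*) [Ring A] [Algebra K A] extends X.Lattice A where
  one_mem : ∀ p, (1 : A) ∈ stalk p
  mul_mem : ∀ p, ∀ a ∈ stalk p, ∀ b ∈ stalk p, a * b ∈ stalk p

namespace Order

variable {X : ACurve K} {A : Type*} [Ring A] [Algebra K A]

/-- A maximal order: an order not properly contained in another order. -/
def IsMaximal (D : X.Order A) : Prop :=
  ∀ E : X.Order A, (∀ p, D.stalk p ≤ E.stalk p) → E = D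

/-- An Eichler order: the intersection of two (possibly equal) maximal orders. -/
def IsEichler (D : X.Order A) : Prop :=
  ∃ M₁ M₂ : X.Order A, M₁.IsMaximal ∧ M₂.IsMaximal ∧
    ∀ p, D.stalk p = M₁.stalk p ⊓ M₂.stalk p

/-- `D = 𝒪_X + I D₀`. -/
def EqUnitAddIdealMul (D : X.Order A) (I : X.IntegralIdeal) (D₀ : X.Order A) : Prop :=
  ∀ p, D.stalk p = 1 ⊔ I.stalk p • D₀.stalk p

end Order

end ACurve

/-! The statement is local. An element of a global field lies in all but finitely many of its
valuation rings, so two lattices have the same stalk at almost every closed point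
(`Lattice.finite_stalk_ne`). Hence an order may be changed arbitrarily at finitely many points, and
it is maximal exactly when all its stalks are (`Order.isMaximal_iff`). All three conditions can then
be compared stalk by stalk.

Where `A_℘` is a division algebra, the absolute value of `K_℘` extends to it, and every order lies
in the resulting valuation ring. There is thus only one maximal order
(`IsLocalMaximal.eq_of_division`) and nothing remains to be shown.

At the other points `A_℘ ≅ M₂(F)` with `F = K_℘`. By density of `A` the local maximal orders are the
traces on `A` of the rings `g M₂(𝒪) g⁻¹`, the vertices of the Bruhat–Tits tree of `PGL₂(F)`. In a
finite family of vertices choose two at maximal distance `N`, with a basis adapted to the path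
between them. On a matrix `(a, b; c, d)` in both end orders, any other vertex of the family imposes
the single condition `v(a - d) ≥ r`, where `r` is its distance from the path and `2r ≤ N`
(`exists_mem_hermiteGL_iff_ordGE_sub`). So only the largest `r = k` counts, and one vertex at
distance `k` from the path has the same effect as the whole family: three orders suffice
(`mem_thickEichler_iff_three`). The resulting ring is `𝒪 + π ^ k E`, with `E` the Eichler order of
the path shortened by `k` at both ends (`mem_thickEichler_iff_exists`). Conversely, an Eichler order
and a `k` give such a ring by lengthening the path by `k` at both ends. -/

/-! ### Finiteness of the set of poles of an element of a global field -/

open IsDedekindDomain in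
theorem ValuationSubring.finite_notMem_of_isFractionRing (B : Type*) {L : Type*} [CommRing B]
    [IsDedekindDomain B] [Field L] [Algebra B L] [IsFractionRing B L] (y : L) :
    {V : ValuationSubring L | (∀ b : B, algebraMap B L b ∈ V) ∧ y ∉ V}.Finite := by
  obtain ⟨a, b, hb, rfl⟩ := IsFractionRing.div_surjective (A := B) y
  have hb0 : b ≠ 0 := nonZeroDivisors.ne_zero hb
  have hfin : {w : HeightOneSpectrum B | w.asIdeal ∣ Ideal.span {b}}.Finite :=
    Ideal.finite_factors (by simpa using hb0)
  refine (hfin.image fun w => HeightOneSpectrum.valuationSubringAtPrime L w).subset ?_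
  rintro V ⟨hV, hy⟩
  let f : B →+* V := (algebraMap B L).codRestrict V.toSubring hV
  have hfb : f b ∈ IsLocalRing.maximalIdeal V := by
    rw [IsLocalRing.mem_maximalIdeal, _root_.mem_nonunits_iff]
    intro hu
    obtain ⟨c, hc⟩ := hu.exists_right_inv
    have hc' : algebraMap B L b * (c : L) = 1 := congrArg Subtype.val hc
    apply hy
    rw [div_eq_mul_inv, ← eq_inv_of_mul_eq_one_right hc']
    exact V.mul_mem _ _ (hV a) c.2
  -- The centre of `V` on `B` is a nonzero prime dividing `b`. `V` contains the localization of `B`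
  -- there, which is a discrete valuation ring and so has no proper overring except `L`; hence `V`
  -- equals it.
  let P : Ideal B := (IsLocalRing.maximalIdeal V).comap f
  have hP : P.IsPrime := Ideal.comap_isPrime f _
  have hP0 : P ≠ ⊥ := fun h => hb0 (by simpa [h] using (show b ∈ P from hfb))
  refine ⟨⟨P, hP, hP0⟩, ?_, ?_⟩
  · exact Ideal.dvd_span_singleton.2 hfb
  · refine ValuationSubring.eq_of_le_of_ne_top _ ?_ ?_
    · intro z hz
      obtain ⟨n, ⟨d, hd⟩, hnd⟩ := HeightOneSpectrum.exists_primeCompl_mul_eq_of_integer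
        ⟨P, hP, hP0⟩ z (by
          simp only [HeightOneSpectrum.valuationSubringAtPrime_eq_valuationSubring] at hz; exact hz)
      have hd' : f d ∉ IsLocalRing.maximalIdeal V := hd
      rw [IsLocalRing.mem_maximalIdeal, _root_.mem_nonunits_iff, not_not] at hd'
      obtain ⟨c, hc⟩ := hd'.exists_right_inv
      have hc' : algebraMap B L d * (c : L) = 1 := congrArg Subtype.val hc
      have : z = algebraMap B L n * c := by
        rw [← hnd, mul_assoc, hc', mul_one]
      rw [this]
      exact V.mul_mem _ _ (hV n) c.2
    · rintro rfl
      exact hy trivial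

theorem ValuationSubring.mem_of_pow_mem {K : Type*} [Field K] (V : ValuationSubring K) {x : K}
    {n : ℕ} (hn : n ≠ 0) (h : x ^ n ∈ V) : x ∈ V := by
  rw [← V.valuation_le_one_iff] at h ⊢
  rw [map_pow] at h
  exact (pow_le_one_iff hn).1 h

theorem ValuationSubring.mem_of_isIntegral {K R : Type*} [Field K] [CommRing R] [Algebra R K]
    (V : ValuationSubring K) (hV : ∀ r : R, algebraMap R K r ∈ V) {x : K} (hx : IsIntegral R x) :
    x ∈ V := by
  let f : R →+* V := (algebraMap R K).codRestrict V.toSubring hV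
  obtain ⟨p, hp, hpx⟩ := hx
  have : IsIntegral V x := ⟨p.map f, hp.map f, by
    rw [Polynomial.eval₂_map]; exact hpx⟩
  obtain ⟨y, rfl⟩ := IsIntegrallyClosed.isIntegral_iff.1 this
  exact y.2

/-- The integral closure of `R` in the separable closure `E` of `L` is Dedekind with fraction field
`E`. The purely inseparable part of `K / E` is harmless: some `q ^ n`-th power of each element lies
in `E`, and a valuation ring contains an element once it contains a positive power, so `V` is
determined by its trace on `E`. -/
theorem ValuationSubring.finite_notMem_of_finiteDimensional (R L : Type*) {K : Type*} [CommRing R]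
    [IsDedekindDomain R] [Field L] [Algebra R L] [IsFractionRing R L] [Field K] [Algebra L K]
    [Algebra R K] [IsScalarTower R L K] [FiniteDimensional L K] (y : K) :
    {V : ValuationSubring K | (∀ r : R, algebraMap R K r ∈ V) ∧ y ∉ V}.Finite := by
  let E := separableClosure L K
  have : IsDedekindDomain (integralClosure R E) := integralClosure.isDedekindDomain R L E
  have : IsFractionRing (integralClosure R E) E :=
    integralClosure.isFractionRing_of_finite_extension L E
  have : IsScalarTower R E K := .of_algebraMap_eq fun _ => rfl
  obtain ⟨q, hq⟩ := ExpChar.exists E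
  obtain ⟨n, z, hz⟩ := IsPurelyInseparable.pow_mem E q y
  have hfin := ValuationSubring.finite_notMem_of_isFractionRing (integralClosure R E) z
  refine Set.Finite.of_finite_image (f := fun V => V.comap (algebraMap E K))
    (hfin.subset ?_) ?_
  · rintro _ ⟨V, ⟨hV, hy⟩, rfl⟩
    refine ⟨?_, ?_⟩
    · intro b
      refine V.mem_of_isIntegral hV (R := R) ?_
      exact b.2.map (IsScalarTower.toAlgHom R E K)
    · intro h
      rw [ValuationSubring.mem_comap, hz] at h
      exact hy (V.mem_of_pow_mem (pow_ne_zero _ (expChar_pos E q).ne') h)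
  · intro V _ W _ h
    ext x
    obtain ⟨m, w, hw⟩ := IsPurelyInseparable.pow_mem E q x
    have hm := pow_ne_zero m (expChar_pos E q).ne'
    have h1 : w ∈ V.comap (algebraMap E K) ↔ w ∈ W.comap (algebraMap E K) := by
      simp only at h; rw [h]
    rw [ValuationSubring.mem_comap, ValuationSubring.mem_comap, hw] at h1
    exact ⟨fun hx => W.mem_of_pow_mem hm (h1.1 (pow_mem hx _)),
      fun hx => V.mem_of_pow_mem hm (h1.2 (pow_mem hx _))⟩

open IntermediateField algebraAdjoinAdjoin in
theorem ValuationSubring.finite_notMem_of_mem {k K : Type*} [Field k] [Field K] [Algebra k K]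
    (t : K) [FiniteDimensional k⟮t⟯ K] (y : K) :
    {V : ValuationSubring K | (∀ r : k, algebraMap k K r ∈ V) ∧ t ∈ V ∧ y ∉ V}.Finite := by
  let R := Algebra.adjoin k {t}
  let f : Polynomial k →ₐ[k] R := (Polynomial.aeval (⟨t, Algebra.self_mem_adjoin_singleton k t⟩ : R))
  have hf : Function.Surjective f := by
    rintro ⟨x, hx⟩
    obtain ⟨p, rfl⟩ := (Algebra.adjoin_mem_exists_aeval k t hx)
    refine ⟨p, Subtype.ext ?_⟩
    exact (Polynomial.aeval_algHom_apply R.val _ p).symm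
  have : IsPrincipalIdealRing R := IsPrincipalIdealRing.of_surjective f.toRingHom hf
  refine (ValuationSubring.finite_notMem_of_finiteDimensional R k⟮t⟯ y).subset ?_
  rintro V ⟨hk, ht, hy⟩
  refine ⟨?_, hy⟩
  rintro ⟨r, hr⟩
  change r ∈ V
  induction hr using Algebra.adjoin_induction with
  | mem x hx => rw [Set.mem_singleton_iff.1 hx]; exact ht
  | algebraMap r => exact hk r
  | add x y _ _ hx hy => exact V.add_mem _ _ hx hy
  | mul x y _ _ hx hy => exact V.mul_mem _ _ hx hy

open IntermediateField in
-- Every valuation ring contains `ℤ`, which settles number fields. For function fields the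
-- projective line is covered by two affine charts: each valuation ring contains `t` or `t⁻¹`.
theorem ValuationSubring.finite_notMem_of_isGlobalField {K : Type*} [Field K]
    (hK : IsGlobalField K) (y : K) : {V : ValuationSubring K | y ∉ V}.Finite := by
  obtain h | ⟨p, hp, hR, hfin⟩ := hK
  · refine (ValuationSubring.finite_notMem_of_finiteDimensional ℤ ℚ y).subset ?_
    exact fun V hV => ⟨fun r => by simp, hV⟩
  · let k := ZMod p
    let _ : Algebra k K := ((algebraMap (RatFunc k) K).comp (algebraMap k (RatFunc k))).toAlgebra
    have hst : IsScalarTower k (RatFunc k) K := .of_algebraMap_eq fun _ => rfl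
    let φ : RatFunc k →ₐ[k] K := IsScalarTower.toAlgHom k (RatFunc k) K
    let t : K := φ RatFunc.X
    have hmem : ∀ f : RatFunc k, φ f ∈ k⟮t⟯ := by
      intro f
      have hpoly : ∀ g : Polynomial k, φ (algebraMap _ (RatFunc k) g) ∈ k⟮t⟯ := by
        intro g
        have : φ (algebraMap _ (RatFunc k) g) = Polynomial.aeval t g := by
          rw [← RatFunc.aeval_X_left_eq_algebraMap, ← Polynomial.aeval_algHom_apply]
        rw [this]
        exact algebra_adjoin_le_adjoin k _ (Polynomial.aeval_mem_adjoin_singleton k t)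
      rw [← RatFunc.num_div_denom f, map_div₀]
      exact div_mem (hpoly _) (hpoly _)
    have key : ∀ s : K, k⟮s⟯ = k⟮t⟯ → FiniteDimensional k⟮s⟯ K := by
      intro s hs
      rw [hs]
      let ψ : RatFunc k →+* k⟮t⟯ := φ.toRingHom.codRestrict k⟮t⟯.toSubring hmem
      let _ : Algebra (RatFunc k) k⟮t⟯ := ψ.toAlgebra
      have : IsScalarTower (RatFunc k) k⟮t⟯ K := .of_algebraMap_eq fun _ => rfl
      exact Module.Finite.of_restrictScalars_finite (RatFunc k) k⟮t⟯ K
    have h1 := key t rfl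
    have h2 := key t⁻¹ (by
      apply le_antisymm <;> rw [adjoin_simple_le_iff]
      · exact inv_mem (mem_adjoin_simple_self k t)
      · simpa using inv_mem (mem_adjoin_simple_self k t⁻¹))
    refine ((ValuationSubring.finite_notMem_of_mem (k := k) t y).union
      (ValuationSubring.finite_notMem_of_mem (k := k) t⁻¹ y)).subset ?_
    intro V hV
    have hk : ∀ r : k, algebraMap k K r ∈ V := by
      intro r
      rw [← ZMod.natCast_zmod_val r, map_natCast]
      exact natCast_mem V _
    exact (V.mem_or_inv_mem t).imp (fun h => ⟨hk, h, hV⟩) (fun h => ⟨hk, h, hV⟩)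

theorem ACurve.finite_notMem {K : Type*} [Field K] (hK : IsGlobalField K) (X : ACurve K) (y : K) :
    {p : X.points | y ∉ X.localRing p}.Finite := by
  refine Set.Finite.of_finite_image (f := fun p => X.localRing p)
    ((ValuationSubring.finite_notMem_of_isGlobalField hK y).subset ?_) ?_
  · rintro _ ⟨p, hp, rfl⟩
    exact hp
  · intro p _ q _ h
    exact Subtype.ext (DVRPlace.ext h)

/-! ### Base change of central simple algebras and splitting of quaternion algebras -/

section SimpleBaseChange

variable {K A F : Type*} [Field K] [Ring A] [Algebra K A] [Field F] [Algebra K F]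

theorem Algebra.TensorProduct.basis_repr_mul_tmul_one {ι : Type*} (b : Module.Basis ι K F)
    (z : A ⊗[K] F) (a : A) (j : ι) :
    (Algebra.TensorProduct.basis A b).repr (z * (a ⊗ₜ 1)) j =
      (Algebra.TensorProduct.basis A b).repr z j * a := by
  induction z with
  | zero => simp
  | tmul x y =>
    simp only [Algebra.TensorProduct.tmul_mul_tmul, mul_one,
      Algebra.TensorProduct.basis_repr_tmul, Finsupp.smul_apply, Finsupp.mapRange_apply,
      smul_eq_mul]
    rw [mul_assoc, mul_assoc, Algebra.commutes]
  | add x y hx hy => simp [add_mul, hx, hy]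

/-- Take an element of the ideal with the fewest nonzero coordinates and normalise one coordinate to
`1`. Its commutators with `A` have fewer coordinates, so vanish; its coordinates are then central,
hence in `K`, and the element is `1 ⊗ f` with `f` invertible. -/
theorem IsSimpleRing.tensorProduct [Algebra.IsCentral K A] [IsSimpleRing A] :
    IsSimpleRing (A ⊗[K] F) := by
  classical
  rw [isSimpleRing_iff_isTwoSided_imp]
  let b := Module.Basis.ofVectorSpace K F
  let β := Algebra.TensorProduct.basis A b
  have hnt : Nontrivial (A ⊗[K] F) := inferInstance
  refine ⟨hnt, fun I hI => or_iff_not_imp_left.2 fun hI0 => ?_⟩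
  obtain ⟨z₀, hz₀, hz₀0⟩ := Submodule.exists_mem_ne_zero_of_ne_bot hI0
  have hex : ∃ n, ∃ z ∈ I, z ≠ 0 ∧ (β.repr z).support.card = n := ⟨_, z₀, hz₀, hz₀0, rfl⟩
  obtain ⟨z, hz, hz0, hzn⟩ := Nat.find_spec hex
  have hmin : ∀ w ∈ I, (β.repr w).support.card < (β.repr z).support.card → w = 0 := by
    intro w hw hlt
    by_contra hw0
    rw [hzn] at hlt
    exact Nat.find_min hex hlt ⟨w, hw, hw0, rfl⟩
  obtain ⟨j, hj⟩ : ∃ j, β.repr z j ≠ 0 := by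
    by_contra! h
    exact hz0 (β.repr.map_eq_zero_iff.1 (Finsupp.ext h))
  have hleft : ∀ (a : A) (w : A ⊗[K] F) i, β.repr ((a ⊗ₜ 1) * w) i = a * β.repr w i := by
    intro a w i
    have : (a ⊗ₜ[K] (1 : F)) * w = a • w := by
      induction w with
      | zero => simp
      | tmul x y => simp [TensorProduct.smul_tmul']
      | add x y hx hy => simp [mul_add, hx, hy]
    rw [this]; simp
  have hright : ∀ (a : A) (w : A ⊗[K] F) i, β.repr (w * (a ⊗ₜ 1)) i = β.repr w i * a :=
    fun a w i => Algebra.TensorProduct.basis_repr_mul_tmul_one b w a i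
  -- The `j`-th coordinates of the elements of `I` supported within the support of `z` form a
  -- two-sided ideal. Simplicity of `A` puts `1` in it, which is the normalisation.
  let J : Ideal A :=
    { carrier := {a | ∃ w ∈ I, (β.repr w).support ⊆ (β.repr z).support ∧ β.repr w j = a}
      add_mem' := by
        rintro _ _ ⟨w, hw, hws, rfl⟩ ⟨w', hw', hws', rfl⟩
        refine ⟨w + w', I.add_mem hw hw', ?_, by simp⟩
        rw [map_add]
        exact Finsupp.support_add.trans (Finset.union_subset hws hws')
      zero_mem' := ⟨0, I.zero_mem, by simp, by simp⟩
      smul_mem' := by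
        rintro a _ ⟨w, hw, hws, rfl⟩
        refine ⟨(a ⊗ₜ 1) * w, I.mul_mem_left _ hw, fun i hi => hws ?_, hleft _ _ _⟩
        rw [Finsupp.mem_support_iff, hleft] at hi
        exact Finsupp.mem_support_iff.2 (right_ne_zero_of_mul hi) }
  have hJ : J.IsTwoSided := ⟨by
    rintro _ a ⟨w, hw, hws, rfl⟩
    refine ⟨w * (a ⊗ₜ 1), hI.mul_mem_of_left _ hw, fun i hi => hws ?_, hright _ _ _⟩
    rw [Finsupp.mem_support_iff, hright] at hi
    exact Finsupp.mem_support_iff.2 (left_ne_zero_of_mul hi)⟩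
  have hJtop : J = ⊤ := by
    refine ((isSimpleRing_iff_isTwoSided_imp.1 ‹IsSimpleRing A›).2 J hJ).resolve_left fun h => hj ?_
    have : β.repr z j ∈ J := ⟨z, hz, subset_rfl, rfl⟩
    rwa [h, Ideal.mem_bot] at this
  obtain ⟨w, hw, hws, hwj⟩ : (1 : A) ∈ J := hJtop ▸ Submodule.mem_top
  have hcomm : ∀ a : A, (a ⊗ₜ 1) * w - w * (a ⊗ₜ 1) = 0 := by
    intro a
    refine hmin _ (I.sub_mem (I.mul_mem_left _ hw) (hI.mul_mem_of_left _ hw)) ?_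
    refine Finset.card_lt_card ⟨fun i hi => hws ?_, fun h => ?_⟩
    · rw [Finsupp.mem_support_iff, map_sub, Finsupp.sub_apply, hleft, hright] at hi
      rw [Finsupp.mem_support_iff]
      intro h0
      simp [h0] at hi
    · have := h (Finsupp.mem_support_iff.2 hj)
      rw [Finsupp.mem_support_iff, map_sub, Finsupp.sub_apply, hleft, hright, hwj] at this
      simp at this
  have hcen : ∀ i, ∃ c : K, algebraMap K A c = β.repr w i := by
    intro i
    have : β.repr w i ∈ Subalgebra.center K A := by
      rw [Subalgebra.mem_center_iff]
      intro a
      have := congrArg (fun y => β.repr y i) (hcomm a)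
      simp only [map_sub, Finsupp.sub_apply, hleft, hright, map_zero, Finsupp.zero_apply] at this
      exact sub_eq_zero.1 this
    rw [Algebra.IsCentral.center_eq_bot] at this
    exact Algebra.mem_bot.1 this
  choose c hc using hcen
  obtain ⟨f, hf⟩ : ∃ f : F, w = 1 ⊗ₜ f := by
    refine ⟨∑ i ∈ (β.repr w).support, c i • b i, ?_⟩
    rw [TensorProduct.tmul_sum]
    conv_lhs => rw [← β.linearCombination_repr w]
    rw [Finsupp.linearCombination_apply, Finsupp.sum]
    refine Finset.sum_congr rfl fun i _ => ?_
    rw [← hc, Algebra.TensorProduct.basis_apply, TensorProduct.smul_tmul', smul_eq_mul, mul_one,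
      Algebra.algebraMap_eq_smul_one, TensorProduct.smul_tmul]
  have hf0 : f ≠ 0 := by
    rintro rfl
    rw [TensorProduct.tmul_zero] at hf
    simp [hf] at hwj
  rw [Ideal.eq_top_iff_one]
  have := I.mul_mem_left (1 ⊗ₜ f⁻¹) hw
  rwa [hf, Algebra.TensorProduct.tmul_mul_tmul, mul_one, inv_mul_cancel₀ hf0,
    ← Algebra.TensorProduct.one_def] at this

open Module in
-- By Wedderburn `T` is `M_n(D)` with `n² dim D = 4`. The case `n = 1` would make `T` a division
-- ring, and `n = 2` forces `D = F`.
theorem exists_algEquiv_matrix_two_of_finrank_eq_four {T : Type*} [Ring T] [Algebra F T]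
    [IsSimpleRing T] (hT : finrank F T = 4) (hdiv : ¬ ∀ x : T, x ≠ 0 → IsUnit x) :
    Nonempty (T ≃ₐ[F] Matrix (Fin 2) (Fin 2) F) := by
  have : Module.Finite F T := Module.finite_of_finrank_pos (by omega)
  have : IsArtinianRing T := IsArtinianRing.of_finite F T
  obtain ⟨n, hn, D, _, _, _, ⟨e⟩⟩ := IsSimpleRing.exists_algEquiv_matrix_divisionRing_finite F T
  have hdim : n * n * finrank F D = 4 := by
    rw [← hT, e.toLinearEquiv.finrank_eq, Module.finrank_matrix, Fintype.card_fin]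
  have hn3 : n < 3 := by
    by_contra! h
    have h1 : 0 < finrank F D := Module.finrank_pos
    nlinarith [Nat.mul_le_mul h h]
  interval_cases n
  · simp at hdim
  · exfalso
    apply hdiv
    intro x hx
    have hu : Nonempty (Matrix (Fin 1) (Fin 1) D ≃+* D) := by
      convert! Nonempty.intro (Matrix.uniqueRingEquiv (m := Fin 1) (A := D))
    have e' := e.toRingEquiv.trans hu.some
    have := (e'.map_eq_zero_iff).not.2 hx
    exact (MulEquiv.isUnit_map e').1 (isUnit_iff_ne_zero.2 this)
  · have h1 : finrank F D = 1 := by omega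
    have hbij : Function.Bijective (algebraMap F D) :=
      (Subalgebra.bot_eq_top_iff_finrank_eq_one.2 h1) |> fun h =>
        ⟨(algebraMap F D).injective, fun x => Algebra.mem_bot.1 (h ▸ Algebra.mem_top)⟩
    exact ⟨e.trans (AlgEquiv.ofBijective (Algebra.ofId F D) hbij).symm.mapMatrix⟩

open Module in
/-- A quaternion algebra that is not a division algebra over `F` is split by `F`. -/
theorem exists_algHom_matrix_two [Algebra.IsCentral K A] [IsSimpleRing A] (hA : finrank K A = 4)
    (hdiv : ¬ ∀ x : A ⊗[K] F, x ≠ 0 → IsUnit x) :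
    ∃ φ : A →ₐ[K] Matrix (Fin 2) (Fin 2) F, ∀ (ι : Type) (b : Basis ι K A),
      ∃ b' : Basis ι F (Matrix (Fin 2) (Fin 2) F), ∀ i, b' i = φ (b i) := by
  have := IsSimpleRing.tensorProduct (K := K) (A := A) (F := F)
  let _ : Algebra F (A ⊗[K] F) := Algebra.TensorProduct.rightAlgebra
  let c := Algebra.TensorProduct.commRight K F A
  have : IsSimpleRing (F ⊗[K] A) := IsSimpleRing.of_ringEquiv c.symm.toRingEquiv this
  obtain ⟨e⟩ := exists_algEquiv_matrix_two_of_finrank_eq_four (F := F) (T := F ⊗[K] A)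
    (by rw [Module.finrank_baseChange, hA])
    (fun h => hdiv fun x hx => (MulEquiv.isUnit_map c.symm).1
      (h _ ((c.symm.map_eq_zero_iff).not.2 hx)))
  refine ⟨(e.toAlgHom.restrictScalars K).comp Algebra.TensorProduct.includeRight, ?_⟩
  -- This clause says that `φ` becomes an isomorphism after extension of scalars to `F`, in the form
  -- that the boundedness and density arguments use.
  intro ι b
  exact ⟨(Algebra.TensorProduct.basis F b).map e.toLinearEquiv, fun i => by simp⟩

end SimpleBaseChange

/-! ### Extension of a complete absolute value to a division algebra -/

section DivisionNorm

variable {F : Type*} [NontriviallyNormedField F] {B : Type*} [DivisionRing B] [Algebra F B]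

theorem exists_algHom_adjoinRoot_minpoly (z : B) :
    ∃ ψ : AdjoinRoot (minpoly F z) →ₐ[F] B, ψ (AdjoinRoot.root (minpoly F z)) = z := by
  refine ⟨Ideal.Quotient.liftₐ (Ideal.span {minpoly F z}) (Polynomial.aeval z) ?_, ?_⟩
  · intro p hp
    obtain ⟨q, rfl⟩ := Ideal.mem_span_singleton.1 hp
    rw [map_mul, minpoly.aeval, zero_mul]
  · exact (Ideal.Quotient.liftₐ_apply _ _ _ _).trans (Polynomial.aeval_X z)

theorem spectralValue_minpoly_eq_spectralNorm (z : B) {E : Type*} [Field E] [Algebra F E]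
    (ψ : E →ₐ[F] B) (e : E) (he : ψ e = z) :
    spectralValue (minpoly F z) = spectralNorm F E e := by
  rw [spectralNorm, ← minpoly.algHom_eq ψ ψ.toRingHom.injective, he]

variable [FiniteDimensional F B]

/-- `B` is a left vector space of dimension `m` over the field `F(z)`, and `z` acts on it as a
scalar. Its determinant over `F` is thus the `m`-th power of its norm from `F(z)`, which up to sign
is the constant coefficient. -/
theorem norm_algebraNorm_eq_norm_coeff_minpoly_pow (z : B) :
    ∃ m : ℕ, (minpoly F z).natDegree * m = Module.finrank F B ∧
      ‖Algebra.norm F z‖ = ‖(minpoly F z).coeff 0‖ ^ m := by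
  have hint : IsIntegral F z := Algebra.IsIntegral.isIntegral z
  have hirr : Fact (Irreducible (minpoly F z)) := ⟨minpoly.irreducible hint⟩
  have hne : minpoly F z ≠ 0 := minpoly.ne_zero hint
  let E := AdjoinRoot (minpoly F z)
  let pb := AdjoinRoot.powerBasis hne
  have : FiniteDimensional F E := pb.finite
  obtain ⟨ψ, hψ⟩ := exists_algHom_adjoinRoot_minpoly (F := F) z
  let _ : Module E B := Module.compHom B ψ.toRingHom
  have hsm : ∀ (e : E) (b : B), e • b = ψ e * b := fun _ _ => rfl
  have : IsScalarTower F E B := ⟨fun c e b => by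
    rw [hsm, hsm, map_smul, smul_mul_assoc]⟩
  have : FiniteDimensional E B := Module.Finite.of_restrictScalars_finite F E B
  refine ⟨Module.finrank E B, ?_, ?_⟩
  · have hdeg : Module.finrank F E = (minpoly F z).natDegree := by
      rw [pb.finrank, AdjoinRoot.powerBasis_dim]
    rw [← hdeg, Module.finrank_mul_finrank]
  · have h1 : LinearMap.mulLeft F z =
        ((AdjoinRoot.root (minpoly F z) : E) • (LinearMap.id : B →ₗ[E] B)).restrictScalars F := by
      ext b
      simp [hsm, hψ]
    have h2 : Algebra.norm F z = (Algebra.norm F (AdjoinRoot.root (minpoly F z) : E)) ^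
        Module.finrank E B := by
      rw [Algebra.norm_apply, ← map_pow]
      have : (Algebra.lmul F B) z = LinearMap.mulLeft F z := rfl
      rw [this, h1, LinearMap.det_restrictScalars, LinearMap.det_smul, LinearMap.det_id, mul_one]
    have h3 := Algebra.PowerBasis.norm_gen_eq_coeff_zero_minpoly pb
    rw [AdjoinRoot.powerBasis_gen, AdjoinRoot.minpoly_root hne,
      (minpoly.monic hint).leadingCoeff, inv_one, Polynomial.C_1, mul_one] at h3
    rw [h2, h3, norm_pow, norm_mul, norm_pow, norm_neg, norm_one, one_pow, one_mul]

variable [CompleteSpace F]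

/-- Coordinates are bounded with respect to any norm on a finite-dimensional space over a
complete field. -/
theorem exists_norm_coord_le {F : Type*} [NontriviallyNormedField F] [CompleteSpace F] {V ι : Type*} [AddCommGroup V] [Module F V]
    [Finite ι] (b : Module.Basis ι F V) (w : V → ℝ) (hnn : ∀ x, 0 ≤ w x) (h0 : ∀ x, w x = 0 ↔ x = 0)
    (hadd : ∀ x y, w (x + y) ≤ max (w x) (w y)) (hsmul : ∀ (c : F) x, w (c • x) = ‖c‖ * w x) :
    ∃ C : ℝ, 0 < C ∧ ∀ x i, ‖b.repr x i‖ ≤ C * w x := by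
  have : FiniteDimensional F V := b.finiteDimensional_of_finite
  let G : AddGroupNorm V :=
    { toFun := w
      map_zero' := (h0 0).2 rfl
      add_le' := fun x y => (hadd x y).trans (max_le_add_of_nonneg (hnn x) (hnn y))
      neg' := fun x => by rw [← neg_one_smul F x, hsmul, norm_neg, norm_one, one_mul]
      eq_zero_of_map_eq_zero' := fun x => (h0 x).1 }
  let _ : NormedAddCommGroup V := G.toNormedAddCommGroup
  let _ : NormedSpace F V := { norm_smul_le := fun c x => (hsmul c x).le }
  let f : V →L[F] (ι → F) := LinearMap.toContinuousLinearMap b.equivFun.toLinearMap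
  have := Fintype.ofFinite ι
  obtain ⟨C, hC, hf⟩ := f.bound
  exact ⟨C, hC, fun x i => (norm_le_pi_norm (f x) i).trans (hf x)⟩

variable [IsUltrametricDist F]

/-- Since the algebra norm is multiplicative, this formula makes the spectral value multiplicative
on all of `B`, although `B` is not commutative. -/
theorem spectralValue_minpoly_pow_finrank (z : B) :
    spectralValue (minpoly F z) ^ Module.finrank F B = ‖Algebra.norm F z‖ := by
  have hint : IsIntegral F z := Algebra.IsIntegral.isIntegral z
  have hirr : Fact (Irreducible (minpoly F z)) := ⟨minpoly.irreducible hint⟩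
  have hne : minpoly F z ≠ 0 := minpoly.ne_zero hint
  have : FiniteDimensional F (AdjoinRoot (minpoly F z)) := (AdjoinRoot.powerBasis hne).finite
  obtain ⟨ψ, hψ⟩ := exists_algHom_adjoinRoot_minpoly (F := F) z
  obtain ⟨m, hm, hN⟩ := norm_algebraNorm_eq_norm_coeff_minpoly_pow (F := F) z
  have h1 : minpoly F (AdjoinRoot.root (minpoly F z)) = minpoly F z := by
    rw [← minpoly.algHom_eq ψ ψ.toRingHom.injective, hψ]
  rw [spectralValue_minpoly_eq_spectralNorm z ψ _ hψ,
    spectralNorm.spectralNorm_eq_norm_coeff_zero_rpow, h1, hN, ← hm, pow_mul, one_div,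
    Real.rpow_inv_natCast_pow (norm_nonneg _) (minpoly.natDegree_pos hint).ne']

variable (F B) in
/-- The absolute value of a complete field extends to every finite-dimensional division algebra. -/
theorem exists_absoluteValue_extension : ∃ w : B → ℝ, (∀ x, 0 ≤ w x) ∧ (∀ x, w x = 0 ↔ x = 0) ∧
    (∀ x y, w (x * y) = w x * w y) ∧ (∀ x y, w (x + y) ≤ max (w x) (w y)) ∧
    ∀ c : F, w (algebraMap F B c) = ‖c‖ := by
  have hd : Module.finrank F B ≠ 0 := Module.finrank_pos.ne'
  have hnn : ∀ x : B, 0 ≤ spectralValue (minpoly F x) := fun x => spectralValue_nonneg _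
  have hmul : ∀ x y : B, spectralValue (minpoly F (x * y)) =
      spectralValue (minpoly F x) * spectralValue (minpoly F y) := by
    intro x y
    rw [← pow_left_inj₀ (hnn _) (mul_nonneg (hnn _) (hnn _)) hd, mul_pow,
      spectralValue_minpoly_pow_finrank, spectralValue_minpoly_pow_finrank,
      spectralValue_minpoly_pow_finrank, map_mul, norm_mul]
  have hc : ∀ c : F, spectralValue (minpoly F (algebraMap F B c)) = ‖c‖ := by
    intro c
    rw [minpoly.eq_X_sub_C, spectralValue_X_sub_C]
  have hzero : ∀ x : B, spectralValue (minpoly F x) = 0 ↔ x = 0 := by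
    intro x
    refine ⟨fun h => ?_, fun h => ?_⟩
    · by_contra hx
      have h1 := hmul x x⁻¹
      rw [mul_inv_cancel₀ hx, h, zero_mul, ← map_one (algebraMap F B), hc, norm_one] at h1
      exact one_ne_zero h1
    · rw [h, ← map_zero (algebraMap F B), hc, norm_zero]
  -- Since `1` and `x` lie in the common subfield `F(x)`, the ultrametric inequality is that of the
  -- spectral norm of a field extension. The general case follows by factoring `x` out of `x + y`.
  have hone : ∀ x : B, spectralValue (minpoly F (1 + x)) ≤ max 1 (spectralValue (minpoly F x)) := by
    intro x
    have hint : IsIntegral F x := Algebra.IsIntegral.isIntegral x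
    have hirr : Fact (Irreducible (minpoly F x)) := ⟨minpoly.irreducible hint⟩
    have : FiniteDimensional F (AdjoinRoot (minpoly F x)) :=
      (AdjoinRoot.powerBasis (minpoly.ne_zero hint)).finite
    obtain ⟨ψ, hψ⟩ := exists_algHom_adjoinRoot_minpoly (F := F) x
    rw [spectralValue_minpoly_eq_spectralNorm x ψ _ hψ,
      spectralValue_minpoly_eq_spectralNorm (1 + x) ψ (1 + AdjoinRoot.root _) (by simp [hψ])]
    refine (isNonarchimedean_spectralNorm _ _).trans_eq ?_
    rw [spectralNorm_one]
  refine ⟨fun x => spectralValue (minpoly F x), hnn, hzero, hmul, ?_, hc⟩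
  intro x y
  by_cases hx : x = 0
  · rw [hx, zero_add]; exact le_max_right _ _
  · have h1 : x + y = x * (1 + x⁻¹ * y) := by rw [mul_add, mul_one, mul_inv_cancel_left₀ hx]
    have h2 : y = x * (x⁻¹ * y) := by rw [mul_inv_cancel_left₀ hx]
    calc spectralValue (minpoly F (x + y))
        = spectralValue (minpoly F x) * spectralValue (minpoly F (1 + x⁻¹ * y)) := by rw [h1, hmul]
      _ ≤ spectralValue (minpoly F x) * max 1 (spectralValue (minpoly F (x⁻¹ * y))) :=
        mul_le_mul_of_nonneg_left (hone _) (hnn _)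
      _ = max (spectralValue (minpoly F x)) (spectralValue (minpoly F y)) := by
        rw [mul_max_of_nonneg _ _ (hnn _), mul_one, ← hmul, ← h2]

end DivisionNorm

/-! ### Maximal orders of `M₂(F)` over a discretely valued field -/

section DiscreteValuations

open WithZero

namespace Valuation

variable {F : Type*} [Field F] (v : Valuation F (WithZero (Multiplicative ℤ)))

/-- The order of `x` at the discrete valuation `v` is at least `n`. -/
def OrdGE (n : ℤ) (x : F) : Prop := v x ≤ exp (-n)

variable {v}

theorem ordGE_zero_iff {x : F} : v.OrdGE 0 x ↔ v x ≤ 1 := by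
  rw [OrdGE, neg_zero, exp_zero]

@[simp] theorem ordGE_zero (n : ℤ) : v.OrdGE n 0 := by simp [OrdGE]

@[simp] theorem ordGE_one : v.OrdGE 0 1 := by rw [ordGE_zero_iff, map_one]

theorem OrdGE.mono {n m : ℤ} {x : F} (h : v.OrdGE n x) (hmn : m ≤ n) : v.OrdGE m x :=
  h.trans (exp_le_exp.2 (neg_le_neg hmn))

theorem OrdGE.add {n : ℤ} {x y : F} (hx : v.OrdGE n x) (hy : v.OrdGE n y) : v.OrdGE n (x + y) :=
  v.map_add_le hx hy

theorem OrdGE.sub {n : ℤ} {x y : F} (hx : v.OrdGE n x) (hy : v.OrdGE n y) : v.OrdGE n (x - y) :=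
  v.map_sub_le hx hy

theorem OrdGE.neg {n : ℤ} {x : F} (hx : v.OrdGE n x) : v.OrdGE n (-x) := by
  rwa [OrdGE, v.map_neg]

theorem OrdGE.mul {n m : ℤ} {x y : F} (hx : v.OrdGE n x) (hy : v.OrdGE m y) :
    v.OrdGE (n + m) (x * y) := by
  rw [OrdGE, map_mul, neg_add, exp_add]
  exact mul_le_mul' hx hy

theorem OrdGE.mul' {n m l : ℤ} {x y : F} (hx : v.OrdGE n x) (hy : v.OrdGE m y) (h : l ≤ n + m) :
    v.OrdGE l (x * y) := (hx.mul hy).mono h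

theorem OrdGE.sum {ι : Type*} {s : Finset ι} {n : ℤ} {f : ι → F} (h : ∀ i ∈ s, v.OrdGE n (f i)) :
    v.OrdGE n (∑ i ∈ s, f i) := v.map_sum_le h

theorem exists_map_eq_exp_neg {x : F} (hx : x ≠ 0) : ∃ t : ℤ, v x = exp (-t) :=
  ⟨-log (v x), by rw [neg_neg, exp_log ((v.ne_zero_iff).2 hx)]⟩

theorem exists_ordGE (x : F) : ∃ n : ℕ, v.OrdGE (-n) x := by
  by_cases hx : x = 0
  · exact ⟨0, by simp [hx]⟩
  · obtain ⟨t, ht⟩ := exists_map_eq_exp_neg (v := v) hx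
    refine ⟨t.natAbs, ?_⟩
    rw [OrdGE, ht, exp_le_exp]
    omega

theorem ordGE_iff_of_map_eq {x : F} {t n : ℤ} (hx : v x = exp (-t)) : v.OrdGE n x ↔ n ≤ t := by
  rw [OrdGE, hx, exp_le_exp, neg_le_neg_iff]

theorem ordGE_mul_iff {x y : F} {t n : ℤ} (hx : v x = exp (-t)) :
    v.OrdGE n (x * y) ↔ v.OrdGE (n - t) y := by
  rw [OrdGE, OrdGE, map_mul, hx, show -(n - t) = -(-t) + -n by ring, exp_add, exp_neg (-t),
    le_inv_mul_iff₀ exp_pos]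

theorem map_zpow_eq {π : F} (hπ : v π = exp (-1)) (n : ℤ) : v (π ^ n) = exp (-n) := by
  rw [map_zpow₀, hπ, ← exp_zsmul]; simp

theorem map_pow_eq {π : F} (hπ : v π = exp (-1)) (n : ℕ) : v (π ^ n) = exp (-(n : ℤ)) := by
  rw [← zpow_natCast, map_zpow_eq hπ]

theorem ne_zero_of_map_eq {π : F} {t : ℤ} (hπ : v π = exp t) : π ≠ 0 :=
  v.ne_zero_iff.1 (hπ ▸ exp_ne_zero)

theorem ordGE_zpow_mul_iff {π : F} (hπ : v π = exp (-1)) {y : F} {n m : ℤ} :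
    v.OrdGE n (π ^ m * y) ↔ v.OrdGE (n - m) y := ordGE_mul_iff (map_zpow_eq hπ m)

theorem ordGE_div_of_le {x y : F} (h : v x ≤ v y) : v.OrdGE 0 (x / y) := by
  rw [ordGE_zero_iff, map_div₀]
  exact div_le_one_of_le₀ h zero_le

variable (v) in
/-- The maximal order `g M₂(𝒪) g⁻¹` of `M₂(F)`. -/
def matrixOrder (g : GL (Fin 2) F) : Subring (Matrix (Fin 2) (Fin 2) F) :=
  v.integer.matrix.comap (MulSemiringAction.toRingHom (ConjAct (Matrix (Fin 2) (Fin 2) F)ˣ)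
    (Matrix (Fin 2) (Fin 2) F) (ConjAct.toConjAct g⁻¹))

theorem mem_matrixOrder {g : GL (Fin 2) F} {X : Matrix (Fin 2) (Fin 2) F} :
    X ∈ v.matrixOrder g ↔ ∀ i j, v.OrdGE 0 ((g⁻¹.1 * X * g.1) i j) := by
  simp only [ordGE_zero_iff]
  change (∀ i j, (ConjAct.toConjAct g⁻¹ • X) i j ∈ v.integer) ↔ _
  rw [ConjAct.units_smul_def]
  simp [mem_integer_iff]

theorem mem_matrixOrder_one {X : Matrix (Fin 2) (Fin 2) F} :
    X ∈ v.matrixOrder 1 ↔ ∀ i j, v.OrdGE 0 (X i j) := by simp [mem_matrixOrder]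

theorem mem_matrixOrder_mul {g h : GL (Fin 2) F} {X : Matrix (Fin 2) (Fin 2) F} :
    X ∈ v.matrixOrder (h * g) ↔ (h⁻¹.1 * X * h.1) ∈ v.matrixOrder g := by
  simp only [mem_matrixOrder, mul_inv_rev, Units.val_mul, mul_assoc]

theorem mem_matrixOrder_iff_conj {h : GL (Fin 2) F} {X : Matrix (Fin 2) (Fin 2) F} :
    X ∈ v.matrixOrder h ↔ (h⁻¹.1 * X * h.1) ∈ v.matrixOrder 1 := by
  rw [← mem_matrixOrder_mul, mul_one]

theorem matrixOrder_mul_eq {g k : GL (Fin 2) F} (hk : ∀ i j, v.OrdGE 0 (k.1 i j))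
    (hk' : ∀ i j, v.OrdGE 0 (k⁻¹.1 i j)) : v.matrixOrder (g * k) = v.matrixOrder g := by
  have h1 := mem_matrixOrder_one.2 hk
  have h2 := mem_matrixOrder_one.2 hk'
  ext X
  rw [mem_matrixOrder_mul, mem_matrixOrder_iff_conj, mem_matrixOrder_iff_conj (h := g)]
  refine ⟨fun h => ?_, fun h => Subring.mul_mem _ (Subring.mul_mem _ h2 h) h1⟩
  have h3 := Subring.mul_mem _ (Subring.mul_mem _ h1 h) h2
  convert h3 using 1
  simp [mul_assoc]

theorem matrixOrder_eq_of_smul {g g' : GL (Fin 2) F} {c : F} (hc : c ≠ 0) (h : g'.1 = c • g.1) :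
    v.matrixOrder g' = v.matrixOrder g := by
  have h' : g'⁻¹.1 = c⁻¹ • g⁻¹.1 := by
    apply Units.inv_eq_of_mul_eq_one_right
    rw [h, smul_mul_smul_comm, mul_inv_cancel₀ hc, one_smul]
    exact g.mul_inv
  ext X
  rw [mem_matrixOrder, mem_matrixOrder, h, h', smul_mul_assoc, smul_mul_assoc, mul_smul_comm,
    smul_smul, inv_mul_cancel₀ hc, one_smul]

variable {π : F} (hπ : v π = exp (-1))

/-- The basis change to the lattice spanned by `π ^ s • e₁` and `e₂ + u • e₁`. -/
def hermiteGL (hπ : v π = exp (-1)) (s : ℤ) (u : F) : GL (Fin 2) F :=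
  ⟨!![π ^ s, u; 0, 1], !![π ^ (-s), -(π ^ (-s) * u); 0, 1],
    by
      have := zpow_ne_zero s (ne_zero_of_map_eq hπ)
      ext i j; fin_cases i <;> fin_cases j <;> simp [Matrix.mul_apply, Fin.sum_univ_two, this],
    by
      have := zpow_ne_zero s (ne_zero_of_map_eq hπ)
      ext i j; fin_cases i <;> fin_cases j <;> simp [Matrix.mul_apply, Fin.sum_univ_two, this]⟩

theorem mem_matrixOrder_hermiteGL {s : ℤ} {u : F} {X : Matrix (Fin 2) (Fin 2) F} :
    X ∈ v.matrixOrder (hermiteGL hπ s u) ↔ v.OrdGE 0 (X 0 0 - u * X 1 0) ∧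
      v.OrdGE s (X 0 1 + u * (X 0 0 - X 1 1) - u * u * X 1 0) ∧ v.OrdGE (-s) (X 1 0) ∧
      v.OrdGE 0 (X 1 1 + u * X 1 0) := by
  have h0 := zpow_ne_zero s (ne_zero_of_map_eq hπ)
  have h00 : ((hermiteGL hπ s u)⁻¹.1 * X * (hermiteGL hπ s u).1) 0 0 = X 0 0 - u * X 1 0 := by
    change (!![π ^ (-s), -(π ^ (-s) * u); 0, 1] * X * !![π ^ s, u; 0, 1]) 0 0 = _
    simp [Matrix.mul_apply, Fin.sum_univ_two, -Matrix.cons_mul]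
    field_simp
    ring
  have h01 : ((hermiteGL hπ s u)⁻¹.1 * X * (hermiteGL hπ s u).1) 0 1 =
      π ^ (-s) * (X 0 1 + u * (X 0 0 - X 1 1) - u * u * X 1 0) := by
    change (!![π ^ (-s), -(π ^ (-s) * u); 0, 1] * X * !![π ^ s, u; 0, 1]) 0 1 = _
    simp [Matrix.mul_apply, Fin.sum_univ_two, -Matrix.cons_mul]
    ring
  have h10 : ((hermiteGL hπ s u)⁻¹.1 * X * (hermiteGL hπ s u).1) 1 0 = π ^ s * X 1 0 := by
    change (!![π ^ (-s), -(π ^ (-s) * u); 0, 1] * X * !![π ^ s, u; 0, 1]) 1 0 = _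
    simp [Matrix.mul_apply, Fin.sum_univ_two, -Matrix.cons_mul]
    ring
  have h11 : ((hermiteGL hπ s u)⁻¹.1 * X * (hermiteGL hπ s u).1) 1 1 = X 1 1 + u * X 1 0 := by
    change (!![π ^ (-s), -(π ^ (-s) * u); 0, 1] * X * !![π ^ s, u; 0, 1]) 1 1 = _
    simp [Matrix.mul_apply, Fin.sum_univ_two, -Matrix.cons_mul]
    ring
  rw [mem_matrixOrder, Fin.forall_fin_two, Fin.forall_fin_two, Fin.forall_fin_two, h00, h01, h10,
    h11, ordGE_zpow_mul_iff hπ, ordGE_zpow_mul_iff hπ, sub_neg_eq_add, zero_add, zero_sub]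
  tauto

/-- The vertices with `u = 0` form an apartment of the tree, with `s` as coordinate. Membership in
the orders at `0` and at `N ≥ 0` together means integral entries with the upper right one divisible
by `π ^ N`. -/
theorem mem_matrixOrder_hermiteGL_zero {s : ℤ} {X : Matrix (Fin 2) (Fin 2) F} :
    X ∈ v.matrixOrder (hermiteGL hπ s 0) ↔ v.OrdGE 0 (X 0 0) ∧
      v.OrdGE s (X 0 1) ∧ v.OrdGE (-s) (X 1 0) ∧ v.OrdGE 0 (X 1 1) := by
  simp [mem_matrixOrder_hermiteGL]

theorem hermiteGL_mul_hermiteGL (s t : ℤ) (u : F) :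
    hermiteGL hπ s 0 * hermiteGL hπ t u = hermiteGL hπ (s + t) (π ^ s * u) := by
  ext i j
  change (!![π ^ s, 0; 0, 1] * !![π ^ t, u; 0, 1] : Matrix (Fin 2) (Fin 2) F) i j =
    (!![π ^ (s + t), π ^ s * u; 0, 1] : Matrix (Fin 2) (Fin 2) F) i j
  have := zpow_add₀ (ne_zero_of_map_eq hπ) s t
  fin_cases i <;> fin_cases j <;> simp [Matrix.mul_apply, Fin.sum_univ_two, this]

theorem hermiteGL_zero_zero : hermiteGL hπ 0 0 = 1 := by
  ext i j
  change (!![π ^ (0 : ℤ), 0; 0, 1] : Matrix (Fin 2) (Fin 2) F) i j = (1 : Matrix (Fin 2) (Fin 2) F) i j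
  fin_cases i <;> fin_cases j <;> simp

end Valuation

/-! ### Normal forms of lattices and elementary divisors -/

namespace Valuation

variable {F : Type*} [Field F] {v : Valuation F (WithZero (Multiplicative ℤ))}

/-- The lower triangular matrix with rows `(a, 0)` and `(b, 1)`. -/
def lowerGL (a : Fˣ) (b : F) : GL (Fin 2) F :=
  ⟨!![a.1, 0; b, 1], !![a⁻¹.1, 0; -(b * a⁻¹.1), 1],
    by ext i j; fin_cases i <;> fin_cases j <;> simp [Matrix.mul_apply, Fin.sum_univ_two],
    by ext i j; fin_cases i <;> fin_cases j <;> simp [Matrix.mul_apply, Fin.sum_univ_two]⟩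

/-- The permutation matrix of the transposition. -/
def swapGL (F : Type*) [Field F] : GL (Fin 2) F :=
  ⟨!![0, 1; 1, 0], !![0, 1; 1, 0],
    by ext i j; fin_cases i <;> fin_cases j <;> simp [Matrix.mul_apply, Fin.sum_univ_two],
    by ext i j; fin_cases i <;> fin_cases j <;> simp [Matrix.mul_apply, Fin.sum_univ_two]⟩

theorem matrixOrder_mul_swapGL (g : GL (Fin 2) F) :
    v.matrixOrder (g * swapGL F) = v.matrixOrder g := by
  refine matrixOrder_mul_eq ?_ ?_ <;> intro i j <;>
    fin_cases i <;> fin_cases j <;> simp [swapGL]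

theorem swapGL_mul_self : swapGL F * swapGL F = 1 := by
  ext i j; fin_cases i <;> fin_cases j <;> simp [swapGL, Matrix.mul_apply, Fin.sum_univ_two]

theorem swapGL_mul_apply (m : GL (Fin 2) F) (i j : Fin 2) :
    (swapGL F * m).1 i j = m.1 (1 - i) j := by
  fin_cases i <;> simp [swapGL, Matrix.mul_apply, Fin.sum_univ_two, -Matrix.cons_mul]

theorem mul_swapGL_apply (m : GL (Fin 2) F) (i j : Fin 2) :
    (m * swapGL F).1 i j = m.1 i (1 - j) := by
  fin_cases j <;> simp [swapGL, Matrix.mul_apply, Fin.sum_univ_two, -Matrix.cons_mul]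

theorem matrixOrder_mul_congr {h g g' : GL (Fin 2) F} (H : v.matrixOrder g = v.matrixOrder g') :
    v.matrixOrder (h * g) = v.matrixOrder (h * g') := by
  ext X; rw [mem_matrixOrder_mul, mem_matrixOrder_mul, H]

variable {π : F} (hπ : v π = exp (-1))

/-- Scaling `m` does not change the order, so the lower right entry may be made `1`. As it dominates
its row, the entry to its left is cleared by an integral column operation, and a unit `ε` turns the
remaining diagonal entry into a power of `π`. -/
theorem matrixOrder_eq_hermiteGL {m : GL (Fin 2) F} (hm : v (m.1 1 0) ≤ v (m.1 1 1)) :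
    m.1 1 1 ≠ 0 ∧ ∃ s : ℤ, v ((m.1 0 0 - m.1 0 1 * m.1 1 0 / m.1 1 1) / m.1 1 1) = exp (-s) ∧
      v.matrixOrder m = v.matrixOrder (hermiteGL hπ s (m.1 0 1 / m.1 1 1)) := by
  have hdet : m.1 0 0 * m.1 1 1 - m.1 0 1 * m.1 1 0 ≠ 0 := by
    have := (Matrix.isUnit_iff_isUnit_det _).1 m.isUnit
    rw [Matrix.det_fin_two] at this
    exact this.ne_zero
  have hx : m.1 1 1 ≠ 0 := by
    intro h
    rw [h, map_zero, le_zero_iff, v.zero_iff] at hm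
    rw [h, hm] at hdet
    simp at hdet
  have hy : (m.1 0 0 - m.1 0 1 * m.1 1 0 / m.1 1 1) / m.1 1 1 ≠ 0 := by
    refine div_ne_zero ?_ hx
    rw [sub_ne_zero, Ne, eq_div_iff hx]
    exact sub_ne_zero.1 hdet
  obtain ⟨s, hs⟩ := exists_map_eq_exp_neg (v := v) hy
  refine ⟨hx, s, hs, ?_⟩
  set y := (m.1 0 0 - m.1 0 1 * m.1 1 0 / m.1 1 1) / m.1 1 1 with hydef
  have hπs := zpow_ne_zero s (ne_zero_of_map_eq hπ)
  let ε : Fˣ := Units.mk0 (y / π ^ s) (div_ne_zero hy hπs)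
  have hε : v ε.1 = 1 := by
    change v (y / π ^ s) = 1
    rw [map_div₀, hs, map_zpow_eq hπ, div_self exp_ne_zero]
  have hε' : v ε⁻¹.1 = 1 := by rw [Units.val_inv_eq_inv_val, map_inv₀, hε, inv_one]
  have hl := ordGE_div_of_le hm
  rw [← matrixOrder_mul_eq (g := hermiteGL hπ s _) (k := lowerGL ε (m.1 1 0 / m.1 1 1))]
  · refine matrixOrder_eq_of_smul hx ?_
    ext i j
    change m.1 i j = m.1 1 1 * (!![π ^ s, m.1 0 1 / m.1 1 1; 0, 1] *
      !![ε.1, 0; m.1 1 0 / m.1 1 1, 1] : Matrix (Fin 2) (Fin 2) F) i j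
    fin_cases i <;> fin_cases j
    · simp only [Fin.zero_eta, Matrix.mul_apply, Fin.sum_univ_two, Matrix.of_apply,
        Matrix.cons_val_zero, Matrix.cons_val_one, ε, Units.val_mk0]
      rw [mul_div_cancel₀ _ hπs, hydef]
      field_simp
      ring
    · simp [Matrix.mul_apply, Fin.sum_univ_two, mul_div_cancel₀ _ hx]
    · simp [Matrix.mul_apply, Fin.sum_univ_two, mul_div_cancel₀ _ hx]
    · simp [Matrix.mul_apply, Fin.sum_univ_two]
  · intro i j
    fin_cases i <;> fin_cases j
    · exact ordGE_zero_iff.2 hε.le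
    · exact ordGE_zero _
    · exact hl
    · exact ordGE_one
  · intro i j
    fin_cases i <;> fin_cases j
    · exact ordGE_zero_iff.2 hε'.le
    · exact ordGE_zero _
    · exact (hl.mul' (ordGE_zero_iff.2 hε'.le) (by simp)).neg
    · exact ordGE_one

/-- Every lattice class has a basis in Hermite normal form. -/
theorem exists_matrixOrder_eq_hermiteGL (h g : GL (Fin 2) F) :
    ∃ s u, v.matrixOrder g = v.matrixOrder (h * hermiteGL hπ s u) := by
  have key : ∀ m : GL (Fin 2) F, ∃ s u, v.matrixOrder m = v.matrixOrder (hermiteGL hπ s u) := by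
    intro m
    rcases le_total (v (m.1 1 0)) (v (m.1 1 1)) with hm | hm
    · obtain ⟨-, s, -, hs⟩ := matrixOrder_eq_hermiteGL hπ hm
      exact ⟨s, _, hs⟩
    · have hm' : v ((m * swapGL F).1 1 0) ≤ v ((m * swapGL F).1 1 1) := by
        simpa [swapGL, Matrix.mul_apply, Fin.sum_univ_two] using hm
      obtain ⟨-, s, -, hs⟩ := matrixOrder_eq_hermiteGL hπ hm'
      exact ⟨s, _, (matrixOrder_mul_swapGL m).symm.trans hs⟩
  obtain ⟨s, u, hsu⟩ := key (h⁻¹ * g)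
  exact ⟨s, u, by rw [← matrixOrder_mul_congr hsu, mul_inv_cancel_left]⟩

/-- The theorem on elementary divisors, for maximal orders. -/
theorem exists_matrixOrder_eq_and_eq (g₁ g₂ : GL (Fin 2) F) : ∃ (h : GL (Fin 2) F) (n : ℕ),
    v.matrixOrder g₁ = v.matrixOrder h ∧
      v.matrixOrder g₂ = v.matrixOrder (h * hermiteGL hπ n 0) := by
  -- If the lower right entry dominates all others, then `u` is integral and `s ≥ 0`; thus
  -- `hermiteGL hπ 0 u` lies in `GL₂(𝒪)` and splits off on the left. Permuting rows and columns
  -- moves a dominant entry to that corner.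
  have key : ∀ m : GL (Fin 2) F, (∀ i j, v (m.1 i j) ≤ v (m.1 1 1)) → ∃ (h : GL (Fin 2) F) (n : ℕ),
      v.matrixOrder 1 = v.matrixOrder h ∧
        v.matrixOrder m = v.matrixOrder (h * hermiteGL hπ n 0) := by
    intro m hm
    obtain ⟨hx, s, hs, hms⟩ := matrixOrder_eq_hermiteGL hπ (hm 1 0)
    have hu : v.OrdGE 0 (m.1 0 1 / m.1 1 1) := ordGE_div_of_le (hm 0 1)
    have hs0 : 0 ≤ s := by
      rw [← ordGE_iff_of_map_eq hs, sub_div, mul_div_assoc]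
      exact (ordGE_div_of_le (hm 0 0)).sub
        (by simpa [mul_div_right_comm] using hu.mul (ordGE_div_of_le (hm 1 0)))
    refine ⟨hermiteGL hπ 0 (m.1 0 1 / m.1 1 1), s.toNat, ?_, ?_⟩
    · symm
      rw [← one_mul (hermiteGL hπ 0 _)]
      refine matrixOrder_mul_eq ?_ ?_ <;> intro i j <;>
        fin_cases i <;> fin_cases j <;> simp [hermiteGL, hu, hu.neg]
    · rw [hms, Int.toNat_of_nonneg hs0]
      congr 1
      ext i j
      change (!![π ^ s, m.1 0 1 / m.1 1 1; 0, 1] : Matrix (Fin 2) (Fin 2) F) i j =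
        (!![π ^ (0 : ℤ), m.1 0 1 / m.1 1 1; 0, 1] * !![π ^ s, 0; 0, 1] :
          Matrix (Fin 2) (Fin 2) F) i j
      fin_cases i <;> fin_cases j <;> simp [Matrix.mul_apply, Fin.sum_univ_two]
  have hleft : ∀ m : GL (Fin 2) F, (∃ (h : GL (Fin 2) F) (n : ℕ),
      v.matrixOrder 1 = v.matrixOrder h ∧
        v.matrixOrder (swapGL F * m) = v.matrixOrder (h * hermiteGL hπ n 0)) →
      ∃ (h : GL (Fin 2) F) (n : ℕ), v.matrixOrder 1 = v.matrixOrder h ∧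
        v.matrixOrder m = v.matrixOrder (h * hermiteGL hπ n 0) := by
    rintro m ⟨h, n, h1, h2⟩
    refine ⟨swapGL F * h, n, ?_, ?_⟩
    · rw [← matrixOrder_mul_congr h1, mul_one, ← matrixOrder_mul_swapGL 1, one_mul]
    · rw [mul_assoc, ← matrixOrder_mul_congr h2, ← mul_assoc, swapGL_mul_self, one_mul]
  have all : ∀ m : GL (Fin 2) F, ∃ (h : GL (Fin 2) F) (n : ℕ),
      v.matrixOrder 1 = v.matrixOrder h ∧
        v.matrixOrder m = v.matrixOrder (h * hermiteGL hπ n 0) := by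
    intro m
    obtain ⟨⟨i, j⟩, hij⟩ := Finite.exists_max fun p : Fin 2 × Fin 2 => v (m.1 p.1 p.2)
    have hmax : ∀ a b, v (m.1 a b) ≤ v (m.1 i j) := fun a b => hij (a, b)
    clear hij
    fin_cases i <;> fin_cases j
    · refine hleft _ ?_
      rw [← matrixOrder_mul_swapGL (swapGL F * m)]
      refine key _ fun a b => ?_
      simp only [swapGL_mul_apply, mul_swapGL_apply]
      exact hmax _ _
    · refine hleft _ (key _ fun a b => ?_)
      simp only [swapGL_mul_apply]
      exact hmax _ _
    · rw [← matrixOrder_mul_swapGL m]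
      refine key _ fun a b => ?_
      simp only [mul_swapGL_apply]
      exact hmax _ _
    · exact key _ hmax
  obtain ⟨h, n, h1, h2⟩ := all (g₁⁻¹ * g₂)
  refine ⟨g₁ * h, n, ?_, ?_⟩
  · rw [← matrixOrder_mul_congr h1, mul_one]
  · rw [mul_assoc, ← matrixOrder_mul_congr h2, mul_inv_cancel_left]

/-- A lattice of rank two is free, so that its endomorphisms lie in a maximal order. -/
theorem exists_forall_mem_matrixOrder_of_stable (hπ : v π = exp (-1))
    (L : AddSubgroup (Fin 2 → F))
    (hsmul : ∀ c, v.OrdGE 0 c → ∀ w ∈ L, c • w ∈ L) (hint : ∀ w ∈ L, ∀ i, v.OrdGE 0 (w i))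
    (hbig : ∃ n : ℕ, ∀ w : Fin 2 → F, (∀ i, v.OrdGE n (w i)) → w ∈ L) :
    ∃ g : GL (Fin 2) F, ∀ X : Matrix (Fin 2) (Fin 2) F, (∀ w ∈ L, X.mulVec w ∈ L) →
      X ∈ v.matrixOrder g := by
  classical
  obtain ⟨n, hn⟩ := hbig
  have hpn : v (π ^ n) = exp (-(n : ℤ)) := map_pow_eq hπ n
  have hpn' : v.OrdGE n (π ^ n) := hpn.le
  -- a vector of minimal order in a given coordinate
  have hmin : ∀ (P : (Fin 2 → F) → Prop) (i : Fin 2), (∃ w ∈ L, P w ∧ w i ≠ 0) →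
      ∃ w ∈ L, P w ∧ w i ≠ 0 ∧ ∀ w' ∈ L, P w' → v (w' i) ≤ v (w i) := by
    intro P i ⟨w₀, hw₀, hP₀, hi₀⟩
    have hval : ∀ w ∈ L, w i ≠ 0 → ∃ t : ℕ, v (w i) = exp (-(t : ℤ)) := by
      intro w hw hi
      obtain ⟨t, ht⟩ := exists_map_eq_exp_neg (v := v) hi
      have := (ordGE_iff_of_map_eq ht).1 (hint w hw i)
      exact ⟨t.toNat, by rw [ht, Int.toNat_of_nonneg this]⟩
    have hex : ∃ t : ℕ, ∃ w ∈ L, P w ∧ v (w i) = exp (-(t : ℤ)) := by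
      obtain ⟨t, ht⟩ := hval w₀ hw₀ hi₀
      exact ⟨t, w₀, hw₀, hP₀, ht⟩
    obtain ⟨w, hw, hP, ht⟩ := Nat.find_spec hex
    refine ⟨w, hw, hP, ne_zero_of_map_eq ht, fun w' hw' hP' => ?_⟩
    by_cases hi : w' i = 0
    · rw [hi, map_zero]; exact zero_le
    · obtain ⟨t', ht'⟩ := hval w' hw' hi
      rw [ht, ht', exp_le_exp, neg_le_neg_iff, Int.ofNat_le]
      exact Nat.find_min' hex ⟨w', hw', hP', ht'⟩
  have hπn : π ^ n ≠ 0 := ne_zero_of_map_eq hpn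
  -- `p` generates the intersection of `L` with the first axis, and the second coordinate of `q`
  -- generates the projection of `L` to the second axis. So `p` and `q` form a triangular basis of
  -- `L`.
  obtain ⟨p, hp, hp1, hp0, hpmin⟩ := hmin (fun w => w 1 = 0) 0
    ⟨![π ^ n, 0], hn _ (by intro i; fin_cases i <;> simp [hpn']), by simp, by simpa using hπn⟩
  obtain ⟨q, hq, -, hq1, hqmin⟩ := hmin (fun _ => True) 1
    ⟨![0, π ^ n], hn _ (by intro i; fin_cases i <;> simp [hpn']), trivial, by simpa using hπn⟩
  let g : GL (Fin 2) F := ⟨!![p 0, q 0; 0, q 1],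
    !![(p 0)⁻¹, -((p 0)⁻¹ * q 0 * (q 1)⁻¹); 0, (q 1)⁻¹],
    by
      ext i j
      fin_cases i <;> fin_cases j <;> simp [Matrix.mul_apply, Fin.sum_univ_two, hp0, hq1]
      field_simp
      ring,
    by ext i j; fin_cases i <;> fin_cases j <;> simp [Matrix.mul_apply, Fin.sum_univ_two, hp0, hq1]⟩
  have hcoord : ∀ w ∈ L, ∀ i, v.OrdGE 0 (g⁻¹.1.mulVec w i) := by
    intro w hw
    have h1 : v.OrdGE 0 (w 1 / q 1) := ordGE_div_of_le (hqmin w hw trivial)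
    have hw' : w - (w 1 / q 1) • q ∈ L := L.sub_mem hw (hsmul _ h1 _ hq)
    have h0 := ordGE_div_of_le (hpmin _ hw' (by simp [div_mul_cancel₀ _ hq1]))
    intro i
    fin_cases i
    · convert h0 using 1
      change (!![(p 0)⁻¹, -((p 0)⁻¹ * q 0 * (q 1)⁻¹); 0, (q 1)⁻¹] :
        Matrix (Fin 2) (Fin 2) F).mulVec w 0 = _
      simp [Matrix.mulVec, dotProduct, Fin.sum_univ_two]
      field_simp
      ring
    · convert h1 using 1
      change (!![(p 0)⁻¹, -((p 0)⁻¹ * q 0 * (q 1)⁻¹); 0, (q 1)⁻¹] :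
        Matrix (Fin 2) (Fin 2) F).mulVec w 1 = _
      simp [Matrix.mulVec, dotProduct, Fin.sum_univ_two]
      field_simp
  refine ⟨g, fun X hX => mem_matrixOrder.2 fun i j => ?_⟩
  have hcol : (fun i => g.1 i j) ∈ L := by
    fin_cases j
    · convert hp using 1
      ext i; fin_cases i <;> simp [g, hp1]
    · convert hq using 1
      ext i; fin_cases i <;> simp [g]
  have := hcoord _ (hX _ hcol) i
  convert this using 1
  rw [Matrix.mul_assoc]
  rfl

end Valuation

/-! ### Intersections of finitely many maximal orders of `M₂(F)` -/

namespace Valuation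

variable {F : Type*} [Field F] {v : Valuation F (WithZero (Multiplicative ℤ))}

variable (v) in
/-- The matrices in `𝒪 + π ^ k E`, where `E` is the Eichler order of level `N - 2 * k` at
distance `k` from the order of `h` on the path of length `N` given by the basis `h`. -/
def thickEichler (h : GL (Fin 2) F) (N k : ℕ) : Set (Matrix (Fin 2) (Fin 2) F) :=
  {X | v.OrdGE 0 ((h⁻¹.1 * X * h.1) 0 0) ∧ v.OrdGE N ((h⁻¹.1 * X * h.1) 0 1) ∧
    v.OrdGE 0 ((h⁻¹.1 * X * h.1) 1 0) ∧ v.OrdGE 0 ((h⁻¹.1 * X * h.1) 1 1) ∧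
    v.OrdGE k ((h⁻¹.1 * X * h.1) 0 0 - (h⁻¹.1 * X * h.1) 1 1)}

variable {π : F} (hπ : v π = exp (-1))

/-- For `X` in both end orders of the path, the terms `X 0 1` and `u * u * X 1 0` already have order
at least `s`, so only the term in `X 0 0 - X 1 1` can obstruct membership. -/
theorem mem_matrixOrder_hermiteGL_iff {N : ℕ} {s : ℤ} {u : F} (hs0 : 0 ≤ s) (hsN : s ≤ N)
    (hu : v.OrdGE 0 u) (huu : v.OrdGE s (u * u)) {X : Matrix (Fin 2) (Fin 2) F}
    (h1 : X ∈ v.matrixOrder 1) (hN : X ∈ v.matrixOrder (hermiteGL hπ N 0)) :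
    X ∈ v.matrixOrder (hermiteGL hπ s u) ↔ v.OrdGE s (u * (X 0 0 - X 1 1)) := by
  rw [mem_matrixOrder_one] at h1
  rw [mem_matrixOrder_hermiteGL_zero] at hN
  have hc : v.OrdGE s (u * u * X 1 0) := huu.mul' (h1 1 0) (by omega)
  have hb : v.OrdGE s (X 0 1) := hN.2.1.mono hsN
  have huc : v.OrdGE 0 (u * X 1 0) := hu.mul' (h1 1 0) le_rfl
  rw [mem_matrixOrder_hermiteGL]
  refine ⟨fun h => ?_, fun h => ⟨(h1 0 0).sub huc, (hb.add h).sub hc, (h1 1 0).mono (by omega),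
    (h1 1 1).add huc⟩⟩
  convert (h.2.1.add hc).sub hb using 1
  ring

/-- The hypotheses say that the vertex has distance at most `N` from both ends of the path. The
number `r` is its distance from the path itself: `0` if `v u` allows `u` to be removed, otherwise `s
- t` with `t` the order of `u`. -/
theorem exists_mem_hermiteGL_iff_ordGE_sub {N : ℕ} {s : ℤ} {u : F}
    (H1 : ∀ X ∈ v.matrixOrder 1, π ^ N • X ∈ v.matrixOrder (hermiteGL hπ s u))
    (HN : ∀ X ∈ v.matrixOrder (hermiteGL hπ N 0),
      π ^ N • X ∈ v.matrixOrder (hermiteGL hπ s u)) :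
    ∃ r : ℕ, 2 * r ≤ N ∧ ∀ X ∈ v.matrixOrder 1, X ∈ v.matrixOrder (hermiteGL hπ N 0) →
      (X ∈ v.matrixOrder (hermiteGL hπ s u) ↔ v.OrdGE r (X 0 0 - X 1 1)) := by
  have hπN : v (π ^ N) = exp (-(N : ℤ)) := map_pow_eq hπ N
  have hπN0 : π ^ N ≠ 0 := ne_zero_of_map_eq hπN
  have hsN : s ≤ N := by
    -- The extreme elements of the two end orders, this matrix unit and below `π ^ (-N)` times the
    -- opposite one, already give `0 ≤ s ≤ N`, `u` integral and `π ^ s ∣ u²`.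
    have h := H1 !![0, 1; 0, 0] (mem_matrixOrder_one.2 fun i j => by
      fin_cases i <;> fin_cases j <;> simp)
    rw [mem_matrixOrder_hermiteGL] at h
    simpa [ordGE_iff_of_map_eq hπN] using h.2.1
  have hE := HN !![0, 0; (π ^ N)⁻¹, 0] (by
    rw [mem_matrixOrder_hermiteGL_zero]
    refine ⟨by simp, by simp, ?_, by simp⟩
    have : v ((π ^ N)⁻¹) = exp (-(-(N : ℤ))) := by rw [map_inv₀, hπN, exp_neg (-(N : ℤ))]
    simp [ordGE_iff_of_map_eq this])
  rw [mem_matrixOrder_hermiteGL] at hE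
  simp only [Matrix.smul_apply, Matrix.of_apply, Matrix.cons_val_zero, Matrix.cons_val_one,
    smul_eq_mul, mul_zero, mul_inv_cancel₀ hπN0, mul_one, zero_sub, sub_zero, zero_add] at hE
  obtain ⟨-, huu, hs0, hu⟩ := hE
  replace huu : v.OrdGE s (u * u) := by simpa using huu.neg
  replace hs0 : 0 ≤ s := by
    have h1 : v (1 : F) = exp (-(0 : ℤ)) := by rw [map_one, neg_zero, exp_zero]
    rw [ordGE_iff_of_map_eq h1] at hs0
    omega
  by_cases hus : v.OrdGE s u
  · refine ⟨0, by omega, fun X hX1 hXN => ?_⟩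
    rw [mem_matrixOrder_hermiteGL_iff hπ hs0 hsN hu huu hX1 hXN]
    rw [mem_matrixOrder_one] at hX1
    have := (hX1 0 0).sub (hX1 1 1)
    exact ⟨fun _ => this, fun _ => hus.mul' this (by simp)⟩
  · have hu0 : u ≠ 0 := fun h => hus (by simp [h])
    obtain ⟨t, ht⟩ := exists_map_eq_exp_neg (v := v) hu0
    rw [ordGE_iff_of_map_eq ht, not_le] at hus
    -- This is what yields `2 * (s - t) ≤ s ≤ N`.
    have htt : s ≤ 2 * t := by
      rw [ordGE_mul_iff ht, ordGE_iff_of_map_eq ht] at huu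
      omega
    refine ⟨(s - t).toNat, by omega, fun X hX1 hXN => ?_⟩
    rw [mem_matrixOrder_hermiteGL_iff hπ hs0 hsN hu huu hX1 hXN, ordGE_mul_iff ht,
      Int.toNat_of_nonneg (by omega)]

theorem mem_thickEichler {h : GL (Fin 2) F} {N k : ℕ} {X : Matrix (Fin 2) (Fin 2) F} :
    X ∈ v.thickEichler h N k ↔ X ∈ v.matrixOrder h ∧ X ∈ v.matrixOrder (h * hermiteGL hπ N 0) ∧
      v.OrdGE k ((h⁻¹.1 * X * h.1) 0 0 - (h⁻¹.1 * X * h.1) 1 1) := by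
  rw [mem_matrixOrder_mul, mem_matrixOrder_hermiteGL_zero, mem_matrixOrder, Fin.forall_fin_two,
    Fin.forall_fin_two, Fin.forall_fin_two]
  constructor
  · rintro ⟨h1, h2, h3, h4, h5⟩
    exact ⟨⟨⟨h1, h2.mono (by omega)⟩, h3, h4⟩, ⟨h1, h2, h3.mono (by omega), h4⟩, h5⟩
  · rintro ⟨⟨⟨h1, h2⟩, h3, h4⟩, ⟨-, h6, -, -⟩, h5⟩
    exact ⟨h1, h6, h3, h4, h5⟩

/-- A thickened Eichler order is an intersection of three maximal orders. -/
theorem mem_thickEichler_iff_three (h : GL (Fin 2) F) {N k : ℕ} (hk : 2 * k ≤ N)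
    {X : Matrix (Fin 2) (Fin 2) F} :
    X ∈ v.thickEichler h N k ↔ X ∈ v.matrixOrder h ∧ X ∈ v.matrixOrder (h * hermiteGL hπ N 0) ∧
      X ∈ v.matrixOrder (h * hermiteGL hπ (2 * k : ℕ) (π ^ k)) := by
  rw [mem_thickEichler hπ]
  refine and_congr_right fun h1 => and_congr_right fun h2 => ?_
  rw [mem_matrixOrder_iff_conj] at h1
  rw [mem_matrixOrder_mul] at h2 ⊢
  -- With `u = π ^ k` and `s = 2 * k` the third vertex branches off the path at position `k` and
  -- lies at distance `2 * k - k = k` from it; `2 * k ≤ N` keeps `s` in range.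
  have hπk := map_pow_eq hπ k
  rw [mem_matrixOrder_hermiteGL_iff hπ (by omega) (by omega) ((ordGE_iff_of_map_eq hπk).2 (by omega))
    ((ordGE_mul_iff hπk).2 ((ordGE_iff_of_map_eq hπk).2 (by omega))) h1 h2, ordGE_mul_iff hπk]
  rw [show ((2 * k : ℕ) : ℤ) - k = k by push_cast; ring]

/-- An intersection of finitely many maximal orders is a thickened Eichler order. -/
theorem exists_thickEichler_of_finite (hπ : v π = exp (-1))
    {S : Set (Subring (Matrix (Fin 2) (Fin 2) F))} (hS : S.Finite)
    (hne : S.Nonempty) (hSO : ∀ O ∈ S, ∃ g, O = v.matrixOrder g) :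
    ∃ h N k, 2 * k ≤ N ∧ ∀ X, (∀ O ∈ S, X ∈ O) ↔ X ∈ v.thickEichler h N k := by
  have hint : ∀ (n : ℕ) (g : GL (Fin 2) F) X, X ∈ v.matrixOrder g → π ^ n • X ∈ v.matrixOrder g := by
    intro n g X hX
    rw [mem_matrixOrder] at hX ⊢
    intro i j
    rw [mul_smul_comm, smul_mul_assoc, Matrix.smul_apply, smul_eq_mul,
      ordGE_mul_iff (map_pow_eq hπ n)]
    exact (hX i j).mono (by omega)
  have hpair : ∀ p : Subring (Matrix (Fin 2) (Fin 2) F) × Subring (Matrix (Fin 2) (Fin 2) F),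
      ∃ n : ℕ, p.1 ∈ S → p.2 ∈ S → ∀ X ∈ p.1, π ^ n • X ∈ p.2 := by
    intro p
    by_cases hp : p.1 ∈ S ∧ p.2 ∈ S
    · obtain ⟨g, hg⟩ := hSO _ hp.1
      obtain ⟨g', hg'⟩ := hSO _ hp.2
      obtain ⟨h, n, h1, h2⟩ := exists_matrixOrder_eq_and_eq hπ g g'
      refine ⟨n, fun _ _ X hX => ?_⟩
      rw [hg, h1, mem_matrixOrder_iff_conj, mem_matrixOrder_one] at hX
      rw [hg', h2, mem_matrixOrder_mul, mem_matrixOrder_hermiteGL_zero]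
      simp only [mul_smul_comm, smul_mul_assoc, Matrix.smul_apply, smul_eq_mul,
        ordGE_mul_iff (map_pow_eq hπ n)]
      exact ⟨(hX _ _).mono (by omega), (hX _ _).mono (by omega), (hX _ _).mono (by omega),
        (hX _ _).mono (by omega)⟩
    · exact ⟨0, fun h1 h2 => absurd ⟨h1, h2⟩ hp⟩
  choose n hn using hpair
  have hex : ∃ N : ℕ, ∀ O ∈ S, ∀ O' ∈ S, ∀ X ∈ O, π ^ N • X ∈ O' := by
    obtain ⟨N, hN⟩ := ((hS.prod hS).image n).bddAbove
    refine ⟨N, fun O hO O' hO' X hX => ?_⟩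
    have hle : n (O, O') ≤ N := hN ⟨(O, O'), ⟨hO, hO'⟩, rfl⟩
    rw [← Nat.sub_add_cancel hle, pow_add, mul_smul]
    have := hn (O, O') hO hO' X hX
    obtain ⟨g, hg⟩ := hSO _ hO'
    rw [hg] at this ⊢
    exact hint _ _ _ this
  classical
  -- The least `N` with `π ^ N O ⊆ O'` for all pairs is the diameter of `S` in the tree. It is
  -- attained by some pair, whose connecting path serves as reference.
  obtain ⟨N, hN, hNmin⟩ : ∃ N : ℕ, (∀ O ∈ S, ∀ O' ∈ S, ∀ X ∈ O, π ^ N • X ∈ O') ∧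
      ∀ M < N, ¬ ∀ O ∈ S, ∀ O' ∈ S, ∀ X ∈ O, π ^ M • X ∈ O' :=
    ⟨Nat.find hex, Nat.find_spec hex, fun _ => Nat.find_min hex⟩
  obtain ⟨h, hh, hhN⟩ : ∃ h : GL (Fin 2) F, v.matrixOrder h ∈ S ∧
      v.matrixOrder (h * hermiteGL hπ N 0) ∈ S := by
    have hpick : ∃ O ∈ S, ∃ O' ∈ S, ∀ M < N, ¬ ∀ X ∈ O, π ^ M • X ∈ O' := by
      obtain ⟨O₀, hO₀⟩ := hne
      rcases Nat.eq_zero_or_pos N with h0 | h0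
      · exact ⟨O₀, hO₀, O₀, hO₀, fun M hM => by omega⟩
      · have := hNmin (N - 1) (by omega)
        push Not at this
        obtain ⟨O, hO, O', hO', X, hX, hXO⟩ := this
        refine ⟨O, hO, O', hO', fun M hM hall => hXO ?_⟩
        obtain ⟨g, hg⟩ := hSO _ hO'
        rw [← Nat.sub_add_cancel (show M ≤ N - 1 by omega), pow_add, mul_smul]
        have := hall X hX
        rw [hg] at this ⊢
        exact hint _ _ _ this
    obtain ⟨O, hO, O', hO', hOO⟩ := hpick
    obtain ⟨g, hg⟩ := hSO _ hO
    obtain ⟨g', hg'⟩ := hSO _ hO'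
    obtain ⟨h, m, h1, h2⟩ := exists_matrixOrder_eq_and_eq hπ g g'
    have hmN : m = N := by
      apply le_antisymm
      -- The conjugate by `h` of a matrix unit lies in `O`, and its multiple by `π ^ N` lies in `O'`
      -- only if `m ≤ N`.
      · have := hN O hO O' hO' (h.1 * !![0, 1; 0, 0] * h⁻¹.1) (by
          rw [hg, h1, mem_matrixOrder_iff_conj, mem_matrixOrder_one]
          intro i j
          rw [Matrix.mul_assoc, Matrix.mul_assoc, Matrix.mul_assoc, h.inv_mul, Matrix.mul_one,
            ← Matrix.mul_assoc, h.inv_mul, Matrix.one_mul]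
          fin_cases i <;> fin_cases j <;> simp)
        rw [hg', h2, mem_matrixOrder_mul, mul_smul_comm, smul_mul_assoc, Matrix.mul_assoc,
          Matrix.mul_assoc, Matrix.mul_assoc, h.inv_mul, Matrix.mul_one,
            ← Matrix.mul_assoc, h.inv_mul, Matrix.one_mul, mem_matrixOrder_hermiteGL_zero] at this
        simpa [ordGE_iff_of_map_eq (map_pow_eq hπ N)] using this.2.1
      · by_contra! hlt
        refine hOO m hlt fun X hX => ?_
        rw [hg, h1, mem_matrixOrder_iff_conj, mem_matrixOrder_one] at hX
        rw [hg', h2, mem_matrixOrder_mul, mem_matrixOrder_hermiteGL_zero]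
        simp only [mul_smul_comm, smul_mul_assoc, Matrix.smul_apply, smul_eq_mul,
          ordGE_mul_iff (map_pow_eq hπ m)]
        exact ⟨(hX _ _).mono (by omega), (hX _ _).mono (by omega), (hX _ _).mono (by omega),
          (hX _ _).mono (by omega)⟩
    subst hmN
    exact ⟨h, h1 ▸ hg ▸ hO, h2 ▸ hg' ▸ hO'⟩
  have hr : ∀ O : Subring (Matrix (Fin 2) (Fin 2) F), ∃ r : ℕ, O ∈ S → 2 * r ≤ N ∧
      ∀ X ∈ v.matrixOrder h, X ∈ v.matrixOrder (h * hermiteGL hπ N 0) →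
        (X ∈ O ↔ v.OrdGE r ((h⁻¹.1 * X * h.1) 0 0 - (h⁻¹.1 * X * h.1) 1 1)) := by
    intro O
    by_cases hO : O ∈ S
    · obtain ⟨g, hg⟩ := hSO O hO
      obtain ⟨s, u, hsu⟩ := exists_matrixOrder_eq_hermiteGL hπ h g
      have hconj : ∀ g' : GL (Fin 2) F, v.matrixOrder (h * g') ∈ S → ∀ X ∈ v.matrixOrder g',
          π ^ N • X ∈ v.matrixOrder (hermiteGL hπ s u) := by
        intro g' hg' X hX
        have e : h⁻¹.1 * (h.1 * X * h⁻¹.1) * h.1 = X := by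
          rw [Matrix.mul_assoc, Matrix.mul_assoc, Matrix.mul_assoc, h.inv_mul, Matrix.mul_one,
            ← Matrix.mul_assoc, h.inv_mul, Matrix.one_mul]
        have := hN _ hg' O hO (h.1 * X * h⁻¹.1) (by rwa [mem_matrixOrder_mul, e])
        rwa [hg, hsu, mem_matrixOrder_mul, mul_smul_comm, smul_mul_assoc, e] at this
      obtain ⟨r, hrN, hr⟩ := exists_mem_hermiteGL_iff_ordGE_sub hπ (N := N) (s := s) (u := u)
        (hconj 1 (by rwa [mul_one])) (hconj _ hhN)
      refine ⟨r, fun _ => ⟨hrN, fun X hX1 hX2 => ?_⟩⟩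
      rw [hg, hsu, mem_matrixOrder_mul]
      exact hr _ (mem_matrixOrder_iff_conj.1 hX1) (mem_matrixOrder_mul.1 hX2)
    · exact ⟨0, fun h => absurd h hO⟩
  choose r hr using hr
  -- The conditions `v(a - d) ≥ r` are nested, so the vertex farthest from the path implies all the
  -- others.
  obtain ⟨O, hO, hmax⟩ := Set.exists_max_image S r hS hne
  refine ⟨h, N, r O, (hr O hO).1, fun X => ?_⟩
  rw [mem_thickEichler hπ]
  refine ⟨fun hX => ⟨hX _ hh, hX _ hhN, ((hr O hO).2 X (hX _ hh) (hX _ hhN)).1 (hX O hO)⟩, ?_⟩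
  rintro ⟨h1, h2, h3⟩ O' hO'
  exact ((hr O' hO').2 X h1 h2).2 (h3.mono (by exact_mod_cast hmax O' hO'))

/-- A thickened Eichler order has the form `𝒪 + π ^ k E` for an Eichler order `E`. -/
theorem mem_thickEichler_iff_exists (h : GL (Fin 2) F) {n k : ℕ} {X : Matrix (Fin 2) (Fin 2) F} :
    X ∈ v.thickEichler h (n + 2 * k) k ↔ ∃ c, v.OrdGE 0 c ∧ ∃ Y ∈ v.matrixOrder (h * hermiteGL hπ k 0),
      Y ∈ v.matrixOrder (h * hermiteGL hπ (k + n : ℕ) 0) ∧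
        X = algebraMap F _ c + π ^ k • Y := by
  have hπk := map_pow_eq hπ k
  have hπ0 : π ^ k ≠ 0 := ne_zero_of_map_eq hπk
  have hinv : v ((π ^ k)⁻¹) = exp (-(-(k : ℤ))) := by rw [map_inv₀, hπk, exp_neg (-(k : ℤ))]
  have hsc : ∀ c : F, h⁻¹.1 * algebraMap F (Matrix (Fin 2) (Fin 2) F) c * h.1 = algebraMap F _ c := by
    intro c
    rw [← Algebra.commutes, Matrix.mul_assoc, h.inv_mul, Matrix.mul_one]
  constructor
  · rintro ⟨h1, h2, h3, h4, h5⟩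
    set Z := h⁻¹.1 * X * h.1 with hZ
    -- The scalar is the lower right entry in the adapted basis. After subtracting it and dividing
    -- by `π ^ k`, the off-diagonal entries have orders at least `n + k` and `-k`: the conditions at
    -- positions `k` and `k + n`.
    refine ⟨Z 1 1, h4, (π ^ k)⁻¹ • (X - algebraMap F _ (Z 1 1)), ?_, ?_, ?_⟩
    · rw [mem_matrixOrder_mul, mem_matrixOrder_hermiteGL_zero, mul_smul_comm, smul_mul_assoc,
        Matrix.mul_sub, Matrix.sub_mul, hsc, ← hZ]
      simp only [Matrix.smul_apply, smul_eq_mul, ordGE_mul_iff hinv, Matrix.sub_apply,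
        Matrix.algebraMap_matrix_apply]
      refine ⟨h5.mono (by omega), ?_, ?_, by simp⟩
      · simpa using h2.mono (by omega)
      · simpa using h3
    · rw [mem_matrixOrder_mul, mem_matrixOrder_hermiteGL_zero, mul_smul_comm, smul_mul_assoc,
        Matrix.mul_sub, Matrix.sub_mul, hsc, ← hZ]
      simp only [Matrix.smul_apply, smul_eq_mul, ordGE_mul_iff hinv, Matrix.sub_apply,
        Matrix.algebraMap_matrix_apply]
      refine ⟨h5.mono (by omega), ?_, ?_, by simp⟩
      · simpa using h2.mono (by push_cast; omega)
      · simpa using h3.mono (by omega)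
    · rw [smul_smul, mul_inv_cancel₀ hπ0, one_smul, add_sub_cancel]
  · rintro ⟨c, hc, Y, hY1, hY2, rfl⟩
    rw [mem_matrixOrder_mul, mem_matrixOrder_hermiteGL_zero] at hY1 hY2
    rw [thickEichler, Set.mem_ofPred_eq, Matrix.mul_add, Matrix.add_mul, hsc, mul_smul_comm,
      smul_mul_assoc]
    set Z := h⁻¹.1 * Y * h.1
    have hmul : ∀ {m l : ℤ} {x : F}, v.OrdGE m x → l ≤ k + m → v.OrdGE l (π ^ k * x) :=
      fun hx hl => (ordGE_mul_iff hπk).2 (hx.mono (by omega))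
    simp only [Matrix.add_apply, Matrix.smul_apply, smul_eq_mul, Matrix.algebraMap_matrix_apply]
    refine ⟨?_, ?_, ?_, ?_, ?_⟩
    · simpa using hc.add (hmul hY1.1 (by omega))
    · simpa using hmul hY2.2.1 (by push_cast; omega)
    · simpa using hmul hY1.2.2.1 (by omega)
    · simpa using hc.add (hmul hY1.2.2.2 (by omega))
    · have := hmul (hY1.1.sub hY1.2.2.2) (l := k) (by omega)
      convert this using 1
      simp
      ring

/-- In a basis adapted to both orders, a single matrix unit of the first lies in the second only
when their distance is `0`. -/
theorem matrixOrder_le_antisymm (hπ : v π = exp (-1)) {g g' : GL (Fin 2) F}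
    (hle : v.matrixOrder g ≤ v.matrixOrder g') : v.matrixOrder g = v.matrixOrder g' := by
  obtain ⟨h, n, h1, h2⟩ := exists_matrixOrder_eq_and_eq hπ g g'
  rw [h1, h2] at hle ⊢
  have := hle (x := h.1 * !![0, 1; 0, 0] * h⁻¹.1) (by
    rw [mem_matrixOrder_iff_conj, mem_matrixOrder_one]
    intro i j
    rw [Matrix.mul_assoc, Matrix.mul_assoc, Matrix.mul_assoc, h.inv_mul, Matrix.mul_one,
      ← Matrix.mul_assoc, h.inv_mul, Matrix.one_mul]
    fin_cases i <;> fin_cases j <;> simp)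
  rw [mem_matrixOrder_mul, Matrix.mul_assoc,
    Matrix.mul_assoc, Matrix.mul_assoc, h.inv_mul, Matrix.mul_one,
    ← Matrix.mul_assoc, h.inv_mul, Matrix.one_mul, mem_matrixOrder_hermiteGL_zero] at this
  have h1 : v (1 : F) = exp (-(0 : ℤ)) := by rw [map_one, neg_zero, exp_zero]
  have hn : (n : ℤ) ≤ 0 := by simpa [ordGE_iff_of_map_eq h1] using this.2.1
  have : n = 0 := by omega
  rw [this, Nat.cast_zero, hermiteGL_zero_zero, mul_one]

end Valuation

/-! ### Orders over a valuation ring of `K` -/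

section LocalOrders

variable {K : Type*} [Field K] {R : ValuationSubring K} {A : Type*} [Ring A] [Algebra K A]

/-- An order of maximal rank over a valuation ring `R` of `K`. -/
structure IsLocalOrder (S : Submodule R A) : Prop where
  fg : S.FG
  span_eq_top : Submodule.span K (S : Set A) = ⊤
  one_mem : (1 : A) ∈ S
  mul_mem : ∀ a ∈ S, ∀ b ∈ S, a * b ∈ S

/-- A maximal order over a valuation ring `R` of `K`. -/
def IsLocalMaximal (S : Submodule R A) : Prop :=
  IsLocalOrder S ∧ ∀ T : Submodule R A, IsLocalOrder T → S ≤ T → T = S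

theorem Submodule.fg_of_forall_mul_repr_mem [IsNoetherianRing R] {ι : Type*} [Finite ι]
    (b : Module.Basis ι K A) (S : Submodule R A) {c : K} (hc : c ≠ 0)
    (h : ∀ x ∈ S, ∀ i, c * b.repr x i ∈ R) : S.FG := by
  have := Fintype.ofFinite ι
  have hfg : (Submodule.span R (Set.range fun i => c⁻¹ • b i)).FG :=
    Submodule.fg_span (Set.finite_range _)
  refine hfg.of_le fun x hx => ?_
  rw [← b.sum_repr x]
  refine Submodule.sum_mem _ fun i _ => ?_
  have : b.repr x i • b i = (⟨_, h x hx i⟩ : R) • (c⁻¹ • b i) := by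
    change _ = (c * b.repr x i) • (c⁻¹ • b i)
    rw [smul_smul, mul_comm c, mul_inv_cancel_right₀ hc]
  rw [this]
  exact Submodule.smul_mem _ _ (Submodule.subset_span ⟨i, rfl⟩)

theorem Submodule.span_eq_top_of_forall_exists_smul_mem {S : Submodule R A}
    (h : ∀ x : A, ∃ c : K, c ≠ 0 ∧ c • x ∈ S) : Submodule.span K (S : Set A) = ⊤ := by
  rw [eq_top_iff]
  intro x _
  obtain ⟨c, hc, hcx⟩ := h x
  have := Submodule.smul_mem _ c⁻¹ (Submodule.subset_span (R := K) hcx)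
  rwa [smul_smul, inv_mul_cancel₀ hc, one_smul] at this

end LocalOrders

/-! ### Transfer between orders in `A` and orders in `M₂(F)` -/

namespace Valuation

variable {K : Type*} [Field K] {R : ValuationSubring K} {A : Type*} [Ring A] [Algebra K A]
  {F : Type*} [Field F] [Algebra K F] {v : Valuation F (WithZero (Multiplicative ℤ))}

variable (R v) in
/-- `K` is dense in the valued field `F`, with valuation ring `R`. -/
structure IsDenseIn : Prop where
  mem_iff : ∀ x : K, v.OrdGE 0 (algebraMap K F x) ↔ x ∈ R
  exists_sub : ∀ (y : F) (n : ℕ), ∃ x : K, v.OrdGE n (y - algebraMap K F x)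

variable (hR : IsDenseIn R v) (φ : A →ₐ[K] Matrix (Fin 2) (Fin 2) F)

theorem algebraMap_mul_mem_matrixOrder {g : GL (Fin 2) F} {c : F} (hc : v.OrdGE 0 c)
    {X : Matrix (Fin 2) (Fin 2) F} (hX : X ∈ v.matrixOrder g) : c • X ∈ v.matrixOrder g := by
  rw [mem_matrixOrder] at hX ⊢
  intro i j
  rw [mul_smul_comm, smul_mul_assoc]
  exact hc.mul' (hX i j) le_rfl

theorem algebraMap_mem_matrixOrder {g : GL (Fin 2) F} {c : F} (hc : v.OrdGE 0 c) :
    algebraMap F (Matrix (Fin 2) (Fin 2) F) c ∈ v.matrixOrder g := by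
  rw [Algebra.algebraMap_eq_smul_one]
  exact algebraMap_mul_mem_matrixOrder hc (Subring.one_mem _)

include hR in
theorem IsDenseIn.smul_eq (φ : A →ₐ[K] Matrix (Fin 2) (Fin 2) F) (r : R) (x : A) :
    φ (r • x) = algebraMap K F r • φ x ∧ v.OrdGE 0 (algebraMap K F r) := by
  refine ⟨?_, (hR.mem_iff _).2 r.2⟩
  change φ ((r : K) • x) = _
  rw [map_smul, algebraMap_smul]

/-- The order of `A` that `φ` induces from the order `g M₂(𝒪) g⁻¹`. -/
def IsDenseIn.comapOrder (hR : IsDenseIn R v) (φ : A →ₐ[K] Matrix (Fin 2) (Fin 2) F)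
    (g : GL (Fin 2) F) : Submodule R A where
  carrier := {x | φ x ∈ v.matrixOrder g}
  add_mem' := fun hx hy => by
    rw [Set.mem_ofPred_eq, map_add]; exact Subring.add_mem _ hx hy
  zero_mem' := by rw [Set.mem_ofPred_eq, map_zero]; exact Subring.zero_mem _
  smul_mem' := fun r x hx => by
    obtain ⟨h1, h2⟩ := hR.smul_eq φ r x
    rw [Set.mem_ofPred_eq, h1]
    exact algebraMap_mul_mem_matrixOrder h2 hx

theorem IsDenseIn.mem_comapOrder {g : GL (Fin 2) F} {x : A} :
    x ∈ hR.comapOrder φ g ↔ φ x ∈ v.matrixOrder g := Iff.rfl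

theorem exists_forall_ordGE {ι : Type*} [Finite ι] (f : ι → F) :
    ∃ n : ℕ, ∀ i, v.OrdGE (-n) (f i) := by
  choose n hn using fun i => exists_ordGE (v := v) (f i)
  obtain ⟨N, hN⟩ := (Set.finite_range n).bddAbove
  exact ⟨N, fun i => (hn i).mono (neg_le_neg (by exact_mod_cast hN ⟨i, rfl⟩))⟩

/-- The order is spanned over `𝒪` by four conjugated matrix units, so it suffices to bound `f` on
these. -/
theorem exists_forall_ordGE_of_mem_matrixOrder (g : GL (Fin 2) F)
    (f : Matrix (Fin 2) (Fin 2) F →ₗ[F] F) :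
    ∃ n : ℕ, ∀ X ∈ v.matrixOrder g, v.OrdGE (-n) (f X) := by
  obtain ⟨n, hn⟩ := exists_forall_ordGE (v := v) fun p : Fin 2 × Fin 2 =>
    f (g.1 * Matrix.single p.1 p.2 1 * g⁻¹.1)
  refine ⟨n, fun X hX => ?_⟩
  rw [mem_matrixOrder] at hX
  have e : X = g.1 * (g⁻¹.1 * X * g.1) * g⁻¹.1 := by
    rw [Matrix.mul_assoc, Matrix.mul_assoc, Matrix.mul_assoc, g.mul_inv, Matrix.mul_one,
      ← Matrix.mul_assoc, g.mul_inv, Matrix.one_mul]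
  rw [e, Matrix.matrix_eq_sum_single (g⁻¹.1 * X * g.1), Matrix.mul_sum, Matrix.sum_mul, map_sum]
  refine OrdGE.sum fun i _ => ?_
  rw [Matrix.mul_sum, Matrix.sum_mul, map_sum]
  refine OrdGE.sum fun j _ => ?_
  have : Matrix.single i j ((g⁻¹.1 * X * g.1) i j) =
      (g⁻¹.1 * X * g.1) i j • Matrix.single i j (1 : F) := by
    rw [Matrix.smul_single, smul_eq_mul, mul_one]
  rw [this, mul_smul_comm, smul_mul_assoc, map_smul, smul_eq_mul]
  exact (hX i j).mul' (hn (i, j)) (by simp)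

variable {ϖ : K} (hϖ : v (algebraMap K F ϖ) = exp (-1))

include hR in
theorem IsDenseIn.exists_forall_ordGE_of_fg {D : Submodule R A} (hD : D.FG) :
    ∃ n : ℕ, ∀ x ∈ D, ∀ i j, v.OrdGE (-n) (φ x i j) := by
  obtain ⟨s, rfl⟩ := hD
  obtain ⟨n, hn⟩ := exists_forall_ordGE (v := v) fun p : s × Fin 2 × Fin 2 => φ p.1 p.2.1 p.2.2
  refine ⟨n, fun x hx i j => ?_⟩
  induction hx using Submodule.span_induction with
  | mem x hx => exact hn (⟨x, hx⟩, i, j)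
  | zero => simp
  | add x y _ _ hx hy => rw [map_add]; exact hx.add hy
  | smul r x _ hx =>
    obtain ⟨h1, h2⟩ := hR.smul_eq φ r x
    rw [h1]
    exact h2.mul' hx (by simp)

include hϖ in
/-- Every order is contained in the order of a lattice. -/
theorem IsDenseIn.exists_le_comapOrder {D : Submodule R A} (hD : IsLocalOrder D) :
    ∃ g, D ≤ hR.comapOrder φ g := by
  obtain ⟨n, hn⟩ := hR.exists_forall_ordGE_of_fg φ hD.fg
  -- The vectors that all of `D` maps into `𝒪²`. Since `D` is a ring, `D` preserves `L`; since `1 ∈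
  -- D`, `L` lies in `𝒪²`; since `D` is bounded, `L` contains some `π ^ n 𝒪²`.
  let L : AddSubgroup (Fin 2 → F) :=
    { carrier := {w | ∀ x ∈ D, ∀ i, v.OrdGE 0 ((φ x).mulVec w i)}
      add_mem' := fun h1 h2 x hx i => by
        rw [Matrix.mulVec_add]; exact (h1 x hx i).add (h2 x hx i)
      zero_mem' := fun x _ i => by rw [Matrix.mulVec_zero]; simp
      neg_mem' := fun h1 x hx i => by rw [Matrix.mulVec_neg]; exact (h1 x hx i).neg }
  obtain ⟨g, hg⟩ : ∃ g : GL (Fin 2) F, ∀ X : Matrix (Fin 2) (Fin 2) F,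
      (∀ w ∈ L, X.mulVec w ∈ L) → X ∈ v.matrixOrder g := by
    refine exists_forall_mem_matrixOrder_of_stable hϖ L ?_ ?_ ?_
    · intro c hc w hw x hx i
      rw [Matrix.mulVec_smul]
      exact hc.mul' (hw x hx i) le_rfl
    · intro w hw i
      simpa using hw 1 hD.one_mem i
    · refine ⟨n, fun w hw x hx i => ?_⟩
      change v.OrdGE 0 (∑ j, φ x i j * w j)
      exact OrdGE.sum fun j _ => (hn x hx i j).mul' (hw j) (by simp)
  refine ⟨g, fun x hx => hg _ fun w hw y hy i => ?_⟩
  rw [Matrix.mulVec_mulVec, ← map_mul]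
  exact hw _ (hD.mul_mem _ hy _ hx) i

/-- The scalar `c ∈ 𝒪` can be replaced by an element of `R` congruent to it modulo `ϖ ^ k`, since
the difference is absorbed into the Eichler order. -/
theorem IsDenseIn.map_mem_thickEichler_iff (hϖ : v (algebraMap K F ϖ) = exp (-1))
    (h : GL (Fin 2) F) {n k : ℕ} {x : A} :
    φ x ∈ v.thickEichler h (n + 2 * k) k ↔ ∃ r : R, ∃ y ∈ hR.comapOrder φ (h * hermiteGL hϖ k 0),
      y ∈ hR.comapOrder φ (h * hermiteGL hϖ (k + n : ℕ) 0) ∧ x = algebraMap K A r + ϖ ^ k • y := by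
  have hϖ0 : ϖ ≠ 0 := (map_ne_zero (algebraMap K F)).1 (ne_zero_of_map_eq hϖ)
  have hpow := map_pow_eq hϖ k
  rw [mem_thickEichler_iff_exists hϖ]
  constructor
  · rintro ⟨c, hc, Y, hY1, hY2, hx⟩
    obtain ⟨r, hr⟩ := hR.exists_sub c k
    have hrR : r ∈ R := by
      rw [← hR.mem_iff]
      simpa using hc.sub (hr.mono (m := 0) (by omega))
    have hφy : φ ((ϖ ^ k)⁻¹ • (x - algebraMap K A r)) =
        algebraMap F _ ((algebraMap K F ϖ ^ k)⁻¹ * (c - algebraMap K F r)) + Y := by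
      rw [map_smul, _root_.map_sub, hx, AlgHom.commutes, IsScalarTower.algebraMap_apply K F (Matrix _ _ F), map_mul,
        _root_.map_sub, ← Algebra.smul_def, ← algebraMap_smul F, map_inv₀, map_pow, add_sub_right_comm,
        smul_add, smul_smul _ _ Y, inv_mul_cancel₀ (ne_zero_of_map_eq hpow), one_smul]
    have hint : v.OrdGE 0 ((algebraMap K F ϖ ^ k)⁻¹ * (c - algebraMap K F r)) := by
      have hinv : v ((algebraMap K F ϖ ^ k)⁻¹) = exp (-(-(k : ℤ))) := by
        rw [map_inv₀, hpow, exp_neg (-(k : ℤ))]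
      rw [ordGE_mul_iff hinv]
      simpa using hr
    refine ⟨⟨r, hrR⟩, (ϖ ^ k)⁻¹ • (x - algebraMap K A r), ?_, ?_, ?_⟩
    · rw [hR.mem_comapOrder, hφy]
      exact Subring.add_mem _ (algebraMap_mem_matrixOrder hint) hY1
    · rw [hR.mem_comapOrder, hφy]
      exact Subring.add_mem _ (algebraMap_mem_matrixOrder hint) hY2
    · rw [smul_smul, mul_inv_cancel₀ (pow_ne_zero k hϖ0), one_smul, add_sub_cancel]
  · rintro ⟨r, y, hy1, hy2, rfl⟩
    refine ⟨algebraMap K F r, (hR.mem_iff _).2 r.2, φ y, hy1, hy2, ?_⟩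
    rw [map_add, AlgHom.commutes, map_smul, ← algebraMap_smul F, map_pow,
      IsScalarTower.algebraMap_apply K F (Matrix _ _ F)]

variable (hφ : ∀ (ι : Type) (b : Module.Basis ι K A),
  ∃ b' : Module.Basis ι F (Matrix (Fin 2) (Fin 2) F), ∀ i, b' i = φ (b i))
variable [FiniteDimensional K A]

include hR hφ in
-- Coordinates in a `K`-basis of `A` are approximated one by one; `m` bounds the denominators of the
-- basis matrices.
theorem IsDenseIn.exists_ordGE_sub (X : Matrix (Fin 2) (Fin 2) F) (n : ℕ) :
    ∃ x : A, ∀ i j, v.OrdGE n ((X - φ x) i j) := by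
  let b := Module.finBasis K A
  obtain ⟨b', hb'⟩ := hφ _ b
  obtain ⟨m, hm⟩ := exists_forall_ordGE (v := v)
    fun p : Fin (Module.finrank K A) × Fin 2 × Fin 2 => b' p.1 p.2.1 p.2.2
  choose c hc using fun i => hR.exists_sub (b'.repr X i) (n + m)
  refine ⟨∑ i, c i • b i, fun i j => ?_⟩
  have : X - φ (∑ i, c i • b i) =
      ∑ l, (b'.repr X l - algebraMap K F (c l)) • b' l := by
    conv_lhs => rw [← b'.sum_repr X, map_sum, ← Finset.sum_sub_distrib]
    refine Finset.sum_congr rfl fun l _ => ?_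
    rw [map_smul, sub_smul, algebraMap_smul, hb']
  rw [this, Matrix.sum_apply]
  exact OrdGE.sum fun l _ => (hc l).mul' (hm (l, i, j)) (by push_cast; omega)

theorem exists_forall_mem_matrixOrder (g : GL (Fin 2) F) : ∃ n : ℕ,
    ∀ X : Matrix (Fin 2) (Fin 2) F, (∀ i j, v.OrdGE n (X i j)) → X ∈ v.matrixOrder g := by
  obtain ⟨n, hn⟩ := exists_forall_ordGE (v := v) fun p : Fin 2 × Fin 2 => g.1 p.1 p.2
  obtain ⟨m, hm⟩ := exists_forall_ordGE (v := v) fun p : Fin 2 × Fin 2 => g⁻¹.1 p.1 p.2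
  refine ⟨m + n, fun X hX => mem_matrixOrder.2 fun i j => ?_⟩
  rw [Matrix.mul_apply]
  refine OrdGE.sum fun k _ => ?_
  have h1 : v.OrdGE n ((g⁻¹.1 * X) i k) := by
    rw [Matrix.mul_apply]
    exact OrdGE.sum fun l _ => (hm (i, l)).mul' (hX l k) (by push_cast; omega)
  exact h1.mul' (hn (k, j)) (by simp)

include hφ hϖ in
theorem IsDenseIn.isLocalOrder_comapOrder [IsNoetherianRing R] (g : GL (Fin 2) F) :
    IsLocalOrder (hR.comapOrder φ g) where
  fg := by
    let b := Module.finBasis K A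
    obtain ⟨b', hb'⟩ := hφ _ b
    choose n hn using fun i => exists_forall_ordGE_of_mem_matrixOrder (v := v) g (b'.coord i)
    obtain ⟨N, hN⟩ := (Set.finite_range n).bddAbove
    have hϖ0 : ϖ ≠ 0 := (map_ne_zero (algebraMap K F)).1 (ne_zero_of_map_eq hϖ)
    refine Submodule.fg_of_forall_mul_repr_mem b _ (pow_ne_zero N hϖ0) fun x hx i => ?_
    have hrep : b'.repr (φ x) i = algebraMap K F (b.repr x i) := by
      have : φ x = ∑ l, algebraMap K F (b.repr x l) • b' l := by
        conv_lhs => rw [← b.sum_repr x, map_sum]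
        refine Finset.sum_congr rfl fun l _ => ?_
        rw [map_smul, algebraMap_smul, hb']
      rw [this, b'.repr_sum_self]
    rw [← hR.mem_iff, map_mul, map_pow, ordGE_mul_iff (map_pow_eq hϖ N), ← hrep]
    refine (hn i _ hx).mono ?_
    have : n i ≤ N := hN ⟨i, rfl⟩
    omega
  span_eq_top := by
    refine Submodule.span_eq_top_of_forall_exists_smul_mem fun x => ?_
    have hϖ0 : ϖ ≠ 0 := (map_ne_zero (algebraMap K F)).1 (ne_zero_of_map_eq hϖ)
    obtain ⟨n, hn⟩ := exists_forall_mem_matrixOrder (v := v) g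
    obtain ⟨m, hm⟩ := exists_forall_ordGE (v := v) fun p : Fin 2 × Fin 2 => φ x p.1 p.2
    refine ⟨ϖ ^ (n + m), pow_ne_zero _ hϖ0, ?_⟩
    rw [hR.mem_comapOrder, map_smul]
    refine hn _ fun i j => ?_
    rw [Matrix.smul_apply, Algebra.smul_def, map_pow, ordGE_mul_iff (map_pow_eq hϖ _)]
    exact (hm (i, j)).mono (by push_cast; omega)
  one_mem := by rw [hR.mem_comapOrder, map_one]; exact Subring.one_mem _
  mul_mem := fun a ha b hb => by
    rw [hR.mem_comapOrder, map_mul]; exact Subring.mul_mem _ ha hb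

include hφ in
-- Sufficiently small matrices lie in both orders, so `X` may be replaced by a close element of `A`.
theorem IsDenseIn.matrixOrder_le_of_comapOrder_le {g g' : GL (Fin 2) F}
    (h : hR.comapOrder φ g ≤ hR.comapOrder φ g') : v.matrixOrder g ≤ v.matrixOrder g' := by
  intro X hX
  obtain ⟨n, hn⟩ := exists_forall_mem_matrixOrder (v := v) g
  obtain ⟨n', hn'⟩ := exists_forall_mem_matrixOrder (v := v) g'
  obtain ⟨x, hx⟩ := hR.exists_ordGE_sub φ hφ X (n + n')
  have h1 := hn _ fun i j => (hx i j).mono (by push_cast; omega)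
  have h2 := hn' _ fun i j => (hx i j).mono (by push_cast; omega)
  have h3 : x ∈ hR.comapOrder φ g := by
    rw [hR.mem_comapOrder]
    simpa using Subring.sub_mem _ hX h1
  simpa using Subring.add_mem _ h2 (h h3)

include hφ hϖ in
-- Any larger order lies in the order of some lattice, and an inclusion between orders of lattices
-- is an equality.
theorem IsDenseIn.isLocalMaximal_comapOrder [IsNoetherianRing R] (g : GL (Fin 2) F) :
    IsLocalMaximal (hR.comapOrder φ g) := by
  refine ⟨hR.isLocalOrder_comapOrder φ hϖ hφ g, fun T hT hle => le_antisymm ?_ hle⟩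
  obtain ⟨g', hg'⟩ := hR.exists_le_comapOrder φ hϖ hT
  have := matrixOrder_le_antisymm hϖ (hR.matrixOrder_le_of_comapOrder_le φ hφ (hle.trans hg'))
  intro x hx
  rw [hR.mem_comapOrder, this]
  exact hg' hx

include hφ hϖ in
theorem IsDenseIn.exists_eq_comapOrder [IsNoetherianRing R] {M : Submodule R A}
    (hM : IsLocalMaximal M) : ∃ g, M = hR.comapOrder φ g := by
  obtain ⟨g, hg⟩ := hR.exists_le_comapOrder φ hϖ hM.1
  exact ⟨g, (hM.2 _ (hR.isLocalOrder_comapOrder φ hϖ hφ g) hg).symm⟩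

include hR hφ in
/-- In the split case an intersection of finitely many maximal orders has the form
`R + ϖ ^ k E` with an Eichler order `E`. -/
theorem IsDenseIn.exists_eq_add_pow_smul [IsNoetherianRing R]
    (hϖ : v (algebraMap K F ϖ) = exp (-1)) {S : Set (Submodule R A)} (hS : S.Finite)
    (hne : S.Nonempty) (hmax : ∀ M ∈ S, IsLocalMaximal M) :
    ∃ (k : ℕ) (M₁ M₂ : Submodule R A), IsLocalMaximal M₁ ∧ IsLocalMaximal M₂ ∧
      ∀ x, (∀ M ∈ S, x ∈ M) ↔ ∃ r : R, ∃ y ∈ M₁ ⊓ M₂, x = algebraMap K A r + ϖ ^ k • y := by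
  choose! g hg using fun M (hM : M ∈ S) => hR.exists_eq_comapOrder φ hϖ hφ (hmax M hM)
  obtain ⟨h, N, k, hkN, hX⟩ := exists_thickEichler_of_finite hϖ
    (hS.image fun M => v.matrixOrder (g M)) (hne.image _) (by
      rintro _ ⟨M, -, rfl⟩; exact ⟨_, rfl⟩)
  obtain ⟨n, rfl⟩ := Nat.exists_eq_add_of_le' hkN
  refine ⟨k, _, _, hR.isLocalMaximal_comapOrder φ hϖ hφ (h * hermiteGL hϖ k 0),
    hR.isLocalMaximal_comapOrder φ hϖ hφ (h * hermiteGL hϖ (k + n : ℕ) 0), fun x => ?_⟩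
  have h1 : (∀ M ∈ S, x ∈ M) ↔ φ x ∈ v.thickEichler h (n + 2 * k) k := by
    rw [← hX, Set.forall_mem_image]
    refine forall₂_congr fun M hM => ?_
    conv_lhs => rw [hg M hM]
    exact hR.mem_comapOrder φ
  rw [h1, hR.map_mem_thickEichler_iff φ hϖ]
  simp only [Submodule.mem_inf, and_assoc]

include hR hφ in
/-- In the split case `R + ϖ ^ k E` is the intersection of three maximal orders if `E` is an
Eichler order. -/
theorem IsDenseIn.exists_three [IsNoetherianRing R] (hϖ : v (algebraMap K F ϖ) = exp (-1))
    {M₁ M₂ : Submodule R A} (h₁ : IsLocalMaximal M₁) (h₂ : IsLocalMaximal M₂) (k : ℕ) :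
    ∃ N₁ N₂ N₃ : Submodule R A, IsLocalMaximal N₁ ∧ IsLocalMaximal N₂ ∧ IsLocalMaximal N₃ ∧
      ∀ x, x ∈ N₁ ⊓ N₂ ⊓ N₃ ↔ ∃ r : R, ∃ y ∈ M₁ ⊓ M₂, x = algebraMap K A r + ϖ ^ k • y := by
  obtain ⟨g₁, rfl⟩ := hR.exists_eq_comapOrder φ hϖ hφ h₁
  obtain ⟨g₂, rfl⟩ := hR.exists_eq_comapOrder φ hϖ hφ h₂
  obtain ⟨h', n, e1, e2⟩ := exists_matrixOrder_eq_and_eq hϖ g₁ g₂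
  -- The origin of the path moves back by `k`, so that the given orders sit at positions `k` and `k
  -- + n` of a path of length `n + 2 * k`.
  let h := h' * hermiteGL hϖ (-k) 0
  have e1' : v.matrixOrder g₁ = v.matrixOrder (h * hermiteGL hϖ k 0) := by
    rw [e1, mul_assoc, hermiteGL_mul_hermiteGL, neg_add_cancel, mul_zero, hermiteGL_zero_zero,
      mul_one]
  have e2' : v.matrixOrder g₂ = v.matrixOrder (h * hermiteGL hϖ (k + n : ℕ) 0) := by
    rw [e2, mul_assoc, hermiteGL_mul_hermiteGL, mul_zero, Nat.cast_add, neg_add_cancel_left]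
  refine ⟨_, _, _, hR.isLocalMaximal_comapOrder φ hϖ hφ h,
    hR.isLocalMaximal_comapOrder φ hϖ hφ (h * hermiteGL hϖ (n + 2 * k : ℕ) 0),
    hR.isLocalMaximal_comapOrder φ hϖ hφ (h * hermiteGL hϖ (2 * k : ℕ) (algebraMap K F ϖ ^ k)),
    fun x => ?_⟩
  simp only [Submodule.mem_inf, hR.mem_comapOrder]
  rw [and_assoc, ← mem_thickEichler_iff_three hϖ h (by omega), hR.map_mem_thickEichler_iff φ hϖ]
  simp only [hR.mem_comapOrder, e1', e2', and_assoc]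

end Valuation

/-! ### Uniqueness of the maximal order in the division case -/

section Division

open Valuation

open scoped Valued in
/-- The valuation ring of a finite-dimensional division algebra over a complete discretely valued
field is bounded, and it contains every bounded multiplicatively closed set. -/
theorem Valued.exists_maximal_bounded_subring {F : Type*} [Field F]
    [Valued F (WithZero (Multiplicative ℤ))] [CompleteSpace F]
    [(Valued.v : Valuation F (WithZero (Multiplicative ℤ))).IsRankOneDiscrete]
    {π : F} (hπ : Valued.v π = exp (-1 : ℤ)) {B ι : Type*} [DivisionRing B] [Algebra F B]
    [Finite ι] (b : Module.Basis ι F B) :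
    ∃ O : Subring B, (∀ c : F, Valued.v.OrdGE 0 c → algebraMap F B c ∈ O) ∧
      (∃ n : ℕ, ∀ z ∈ O, ∀ i, Valued.v.OrdGE (-n) (b.repr z i)) ∧
      (∀ z, ∃ n : ℕ, algebraMap F B (π ^ n) * z ∈ O) ∧
      ∀ S : Submonoid B, (∃ n : ℕ, ∀ z ∈ S, ∀ i, Valued.v.OrdGE (-n) (b.repr z i)) →
        ∀ z ∈ S, z ∈ O := by
  have hrk : (Valued.v : Valuation F (WithZero (Multiplicative ℤ))).RankOne :=
    Valuation.IsRankOneDiscrete.rankOne _ (e := 2) one_lt_two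
  have : FiniteDimensional F B := b.finiteDimensional_of_finite
  have := Fintype.ofFinite ι
  obtain ⟨w, hnn, h0, hmul, hadd, hc⟩ := exists_absoluteValue_extension F B
  have hsmul : ∀ (c : F) x, w (c • x) = ‖c‖ * w x := fun c x => by
    rw [Algebra.smul_def, hmul, hc]
  have hone : w 1 = 1 := by rw [← map_one (algebraMap F B), hc, norm_one]
  have hnorm : ∀ c : F, Valued.v.OrdGE 0 c ↔ ‖c‖ ≤ 1 := fun c => by
    rw [ordGE_zero_iff, Valued.toNormedField.norm_le_one_iff]
  have hπ1 : ‖π‖ < 1 := by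
    rw [Valued.toNormedField.norm_lt_one_iff, hπ, ← exp_zero, exp_lt_exp]
    norm_num
  have hpow : ∀ C : ℝ, ∃ n : ℕ, ‖π‖ ^ n * C ≤ 1 := fun C => by
    have h1 := (tendsto_pow_atTop_nhds_zero_of_lt_one (norm_nonneg π) hπ1).mul_const C
    rw [zero_mul] at h1
    exact (h1.eventually (ge_mem_nhds one_pos)).exists
  let O : Subring B :=
    { carrier := {z | w z ≤ 1}
      mul_mem' := fun {a b} ha hb => by
        rw [Set.mem_ofPred_eq, hmul]; exact mul_le_one₀ ha (hnn _) hb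
      one_mem' := hone.le
      add_mem' := fun {a b} ha hb => (hadd a b).trans (max_le ha hb)
      zero_mem' := ((h0 0).2 rfl).le.trans zero_le_one
      neg_mem' := fun {a} ha => by
        rw [Set.mem_ofPred_eq, ← neg_one_smul F a, hsmul, norm_neg, norm_one, one_mul]; exact ha }
  refine ⟨O, fun c hc' => (hc c).le.trans ((hnorm c).1 hc'), ?_, ?_, ?_⟩
  · obtain ⟨C, hC, hb⟩ := exists_norm_coord_le b w hnn h0 hadd hsmul
    obtain ⟨n, hn⟩ := hpow C
    refine ⟨n, fun z hz i => ?_⟩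
    rw [← zero_sub, ← ordGE_mul_iff (map_pow_eq hπ n), hnorm, norm_mul, norm_pow]
    refine le_trans (mul_le_mul_of_nonneg_left ?_ (by positivity)) hn
    exact (hb z i).trans (mul_le_of_le_one_right hC.le hz)
  · intro z
    obtain ⟨n, hn⟩ := hpow (w z)
    refine ⟨n, ?_⟩
    change w _ ≤ 1
    rwa [hmul, hc, norm_pow]
  · rintro S ⟨n, hn⟩ z hz
    -- Bounded coordinates give bounded `w` on `S`; an element of `S` with `w z > 1` would have
    -- unbounded powers in `S`.
    have hbound : ∃ C : ℝ, ∀ x ∈ S, w x ≤ C := by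
      refine ⟨∑ i, ‖(π ^ n)⁻¹‖ * w (b i), fun x hx => ?_⟩
      have hle : ∀ s : Finset ι, w (∑ i ∈ s, b.repr x i • b i) ≤
          ∑ i ∈ s, w (b.repr x i • b i) := by
        intro s
        induction s using Finset.cons_induction with
        | empty => simpa using ((h0 0).2 rfl).le
        | cons i s hi ih =>
          rw [Finset.sum_cons, Finset.sum_cons]
          exact (hadd _ _).trans ((max_le_add_of_nonneg (hnn _) (hnn _)).trans
            (add_le_add le_rfl ih))
      conv_lhs => rw [← b.sum_repr x]
      refine (hle _).trans (Finset.sum_le_sum fun i _ => ?_)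
      rw [hsmul]
      refine mul_le_mul_of_nonneg_right ?_ (hnn _)
      have := hn x hx i
      rw [← zero_sub, ← ordGE_mul_iff (map_pow_eq hπ n), hnorm, norm_mul] at this
      rw [norm_inv, ← one_div, le_div_iff₀ (norm_pos_iff.2 (ne_zero_of_map_eq (map_pow_eq hπ n)))]
      linarith
    obtain ⟨C, hC⟩ := hbound
    change w z ≤ 1
    by_contra! hlt
    obtain ⟨m, hm⟩ := pow_unbounded_of_one_lt C hlt
    have hwm : w (z ^ m) = w z ^ m := by
      clear hm
      induction m with
      | zero => simpa using hone
      | succ m ih => rw [pow_succ, pow_succ, hmul, ih]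
    have := hC _ (pow_mem hz m)
    rw [hwm] at this
    exact absurd this (not_le.2 hm)

/-- If `A` stays a division algebra over the complete field `F`, then there is only one maximal
order over `R`. -/
theorem IsLocalMaximal.eq_of_division {K : Type*} [Field K] {R : ValuationSubring K}
    [IsNoetherianRing R] {A : Type*} [Ring A] [Algebra K A] [FiniteDimensional K A] {F : Type*}
    [Field F] [Algebra K F] [Valued F (WithZero (Multiplicative ℤ))] [CompleteSpace F]
    [(Valued.v : Valuation F (WithZero (Multiplicative ℤ))).IsRankOneDiscrete]
    (hR : IsDenseIn R (Valued.v : Valuation F (WithZero (Multiplicative ℤ)))) {ϖ : K}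
    (hϖ : Valued.v (algebraMap K F ϖ) = exp (-1 : ℤ)) [Nontrivial A]
    (hdiv : ∀ x : A ⊗[K] F, x ≠ 0 → IsUnit x) {M M' : Submodule R A}
    (hM : IsLocalMaximal M) (hM' : IsLocalMaximal M') : M = M' := by
  let _ : Algebra F (A ⊗[K] F) := Algebra.TensorProduct.rightAlgebra
  let c := Algebra.TensorProduct.commRight K F A
  let _ : DivisionRing (F ⊗[K] A) := DivisionRing.ofIsUnitOrEqZero fun x =>
    or_iff_not_imp_right.2 fun hx => (MulEquiv.isUnit_map c).1
      (hdiv _ ((c.map_eq_zero_iff).not.2 hx))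
  let b := Module.finBasis K A
  let β := Algebra.TensorProduct.basis F b
  let j : A →ₐ[K] F ⊗[K] A := Algebra.TensorProduct.includeRight
  have hrepr : ∀ x i, β.repr (j x) i = algebraMap K F (b.repr x i) := fun x i => by
    simp [β, j]
  obtain ⟨O, hOc, ⟨n, hn⟩, hOpow, hO⟩ := Valued.exists_maximal_bounded_subring hϖ β
  have hjR : ∀ (r : R) x, j x ∈ O → j (r • x) ∈ O := by
    intro r x hx
    change j ((r : K) • x) ∈ O
    rw [Algebra.smul_def, map_mul, AlgHom.commutes, IsScalarTower.algebraMap_apply K F (F ⊗[K] A)]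
    exact O.mul_mem (hOc _ ((hR.mem_iff _).2 r.2)) hx
  let T : Submodule R A :=
    { carrier := {x | j x ∈ O}
      add_mem' := fun hx hy => by
        rw [Set.mem_ofPred_eq, map_add]; exact O.add_mem hx hy
      zero_mem' := by rw [Set.mem_ofPred_eq, map_zero]; exact O.zero_mem
      smul_mem' := hjR }
  have hϖ0 : ϖ ≠ 0 := (map_ne_zero (algebraMap K F)).1 (ne_zero_of_map_eq hϖ)
  have hT : IsLocalOrder T :=
    { fg := by
        refine Submodule.fg_of_forall_mul_repr_mem b _ (pow_ne_zero n hϖ0) fun x hx i => ?_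
        rw [← hR.mem_iff, map_mul, map_pow, ordGE_mul_iff (map_pow_eq hϖ n), ← hrepr, zero_sub]
        exact hn _ hx i
      span_eq_top := by
        refine Submodule.span_eq_top_of_forall_exists_smul_mem fun x => ?_
        obtain ⟨m, hm⟩ := hOpow (j x)
        refine ⟨ϖ ^ m, pow_ne_zero m hϖ0, ?_⟩
        change j _ ∈ O
        rwa [Algebra.smul_def, map_mul, AlgHom.commutes,
          IsScalarTower.algebraMap_apply K F (F ⊗[K] A), map_pow]
      one_mem := by change j 1 ∈ O; rw [map_one]; exact O.one_mem
      mul_mem := fun x hx y hy => by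
        change j (x * y) ∈ O; rw [map_mul]; exact O.mul_mem hx hy }
  -- A maximal order is finitely generated, hence bounded, and closed under multiplication. It thus
  -- lies in the trace `T` of the valuation ring, which is itself an order.
  have key : ∀ {N : Submodule R A}, IsLocalMaximal N → T = N := by
    intro N hN
    refine hN.2 T hT fun x hx => ?_
    let S : Submonoid (F ⊗[K] A) :=
      { carrier := j '' N
        one_mem' := ⟨1, hN.1.one_mem, map_one j⟩
        mul_mem' := by
          rintro _ _ ⟨x, hx, rfl⟩ ⟨y, hy, rfl⟩
          exact ⟨x * y, hN.1.mul_mem x hx y hy, map_mul j x y⟩ }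
    refine hO S ?_ (j x) ⟨x, hx, rfl⟩
    obtain ⟨s, hs⟩ := hN.1.fg
    obtain ⟨m, hm⟩ := exists_forall_ordGE (v := Valued.v)
      fun p : s × Fin (Module.finrank K A) => algebraMap K F (b.repr p.1 p.2)
    refine ⟨m, ?_⟩
    rintro _ ⟨y, hy, rfl⟩ i
    rw [hrepr]
    rw [SetLike.mem_coe, ← hs] at hy
    induction hy using Submodule.span_induction with
    | mem x hx => exact hm (⟨x, hx⟩, i)
    | zero => simp
    | add x y _ _ hx hy =>
      rw [map_add, Finsupp.add_apply, map_add]; exact hx.add hy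
    | smul r x _ hx =>
      change Valued.v.OrdGE _ (algebraMap K F (b.repr ((r : K) • x) i))
      rw [map_smul, Finsupp.smul_apply, smul_eq_mul, map_mul]
      exact ((hR.mem_iff _).2 r.2).mul' hx (by simp)
  exact (key hM).symm.trans (key hM')

end Division

/-! ### The completion at a closed point -/

section AdicCompletion

open IsDedekindDomain Valuation IsDiscreteValuationRing

variable {K : Type*} [Field K] (R : ValuationSubring K) [IsDiscreteValuationRing R]

theorem ValuationSubring.isDenseIn_adicCompletion :
    IsDenseIn R (Valued.v : Valuation ((maximalIdeal R).adicCompletion K)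
      (WithZero (Multiplicative ℤ))) := by
  have hv : ∀ x : K, Valued.v (algebraMap K ((maximalIdeal R).adicCompletion K) x) =
      (maximalIdeal R).valuation K x := fun x =>
    HeightOneSpectrum.valuedAdicCompletion_eq_valuation' _ x
  constructor
  · intro x
    rw [ordGE_zero_iff, hv]
    refine ⟨fun h => ?_, fun h => (maximalIdeal R).valuation_le_one (⟨x, h⟩ : R)⟩
    obtain ⟨y, rfl⟩ := exists_lift_of_le_one h
    exact y.2
  · intro y n
    obtain ⟨ϖ, hϖ⟩ := (maximalIdeal R).valuation_exists_uniformizer K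
    rw [← hv] at hϖ
    let F := (maximalIdeal R).adicCompletion K
    let γ := (Valued.v (R := F)).restrict (algebraMap K F ϖ ^ n)
    have hopen : IsOpen {x : F | (Valued.v (R := F)).restrict (y - x) < γ} :=
      (Valued.isOpen_ball F γ).preimage (continuous_const.sub continuous_id)
    obtain ⟨x, hx⟩ := (HeightOneSpectrum.denseRange_algebraMap K (maximalIdeal R)).exists_mem_open
      hopen ⟨y, by
        change (Valued.v (R := F)).restrict (y - y) < γ
        rw [restrict_lt_iff, sub_self, map_zero, map_pow_eq hϖ]
        exact exp_pos⟩
    refine ⟨x, le_of_lt ?_⟩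
    rw [← map_pow_eq hϖ]
    exact (restrict_lt_iff _).1 hx

theorem ValuationSubring.exists_map_eq_exp_neg_one : ∃ ϖ : K,
    Valued.v (algebraMap K ((maximalIdeal R).adicCompletion K) ϖ) = exp (-1 : ℤ) := by
  obtain ⟨ϖ, hϖ⟩ := (maximalIdeal R).valuation_exists_uniformizer K
  exact ⟨ϖ, (HeightOneSpectrum.valuedAdicCompletion_eq_valuation' _ ϖ).trans hϖ⟩

end AdicCompletion

/-! ### Stalks of lattices and of integral ideals -/

section LocalStructure

variable {K : Type*} [Field K] {R : ValuationSubring K} {A : Type*} [Ring A] [Algebra K A]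

/-- Stalks of integral ideals are principal, so this is the elementwise form of `𝒪 + I D₀` at a
point. -/
theorem Submodule.mem_one_sup_span_singleton_smul {c : K} {E : Submodule R A} {x : A} :
    x ∈ 1 ⊔ (Submodule.span R {c} : Submodule R K) • E ↔
      ∃ r : R, ∃ y ∈ E, x = algebraMap K A r + c • y := by
  have hsmul : ∀ z, z ∈ (Submodule.span R {c} : Submodule R K) • E ↔ ∃ y ∈ E, z = c • y := by
    intro z
    constructor
    · intro hz
      induction hz using Submodule.smul_induction_on' with
      | smul r hr n hn =>
        obtain ⟨a, rfl⟩ := Submodule.mem_span_singleton.1 hr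
        refine ⟨a • n, E.smul_mem a hn, ?_⟩
        rw [smul_assoc, smul_comm]
      | add x _ y _ hx hy =>
        obtain ⟨x', hx', rfl⟩ := hx
        obtain ⟨y', hy', rfl⟩ := hy
        exact ⟨x' + y', E.add_mem hx' hy', (smul_add _ _ _).symm⟩
    · rintro ⟨y, hy, rfl⟩
      exact Submodule.smul_mem_smul (Submodule.mem_span_singleton_self c) hy
  rw [Submodule.mem_sup]
  constructor
  · rintro ⟨_, h1, z, hz, rfl⟩
    obtain ⟨r, rfl⟩ := Submodule.mem_one.1 h1
    obtain ⟨y, hy, rfl⟩ := (hsmul z).1 hz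
    exact ⟨r, y, hy, rfl⟩
  · rintro ⟨r, y, hy, rfl⟩
    exact ⟨_, Submodule.mem_one.2 ⟨r, rfl⟩, _, (hsmul _).2 ⟨y, hy, rfl⟩, rfl⟩

theorem Submodule.one_sup_one_smul {E : Submodule R A} (hE : (1 : A) ∈ E) :
    1 ⊔ (1 : Submodule R K) • E = E := by
  rw [Submodule.one_smul, sup_eq_right]
  exact Submodule.one_le.2 hE

theorem Submodule.fg_one : (1 : Submodule R K).FG := by
  rw [Submodule.one_eq_span]
  exact Submodule.fg_span_singleton 1

theorem Submodule.span_one_eq_top : Submodule.span K ((1 : Submodule R K) : Set K) = ⊤ :=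
  (Ideal.eq_top_iff_one _).2 (Submodule.subset_span (Submodule.one_le.1 le_rfl))

theorem Submodule.exists_smul_mem_of_span_eq_top {S : Submodule R A}
    (h : Submodule.span K (S : Set A) = ⊤) (x : A) : ∃ c : R, c ≠ 0 ∧ c • x ∈ S := by
  have hx : x ∈ Submodule.span K (S : Set A) := h ▸ Submodule.mem_top
  induction hx using Submodule.span_induction with
  | mem x hx => exact ⟨1, one_ne_zero, by rwa [one_smul]⟩
  | zero => exact ⟨1, one_ne_zero, by simp⟩
  | add x y _ _ hx hy =>
    obtain ⟨c, hc, hcx⟩ := hx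
    obtain ⟨d, hd, hdy⟩ := hy
    refine ⟨c * d, mul_ne_zero hc hd, ?_⟩
    rw [smul_add, mul_smul c d y, mul_comm, mul_smul]
    exact S.add_mem (S.smul_mem _ hcx) (S.smul_mem _ hdy)
  | smul k x _ hx =>
    obtain ⟨c, hc, hcx⟩ := hx
    -- In a valuation ring either `k` is integral, or its inverse is and serves as a denominator.
    rcases R.mem_or_inv_mem k with hk | hk
    · refine ⟨c, hc, ?_⟩
      rw [smul_comm]
      exact S.smul_mem ⟨k, hk⟩ hcx
    · by_cases hk0 : k = 0
      · exact ⟨1, one_ne_zero, by simp [hk0]⟩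
      · refine ⟨c * ⟨k⁻¹, hk⟩, mul_ne_zero hc fun h => ?_, ?_⟩
        · exact inv_ne_zero hk0 (congrArg Subtype.val h)
        · rw [mul_smul]
          change c • (k⁻¹ • k • x) ∈ S
          rwa [inv_smul_smul₀ hk0]

theorem IsLocalOrder.inf [IsNoetherianRing R] {S T : Submodule R A} (hS : IsLocalOrder S)
    (hT : IsLocalOrder T) : IsLocalOrder (S ⊓ T) where
  fg := hS.fg.of_le inf_le_left
  span_eq_top := by
    refine Submodule.span_eq_top_of_forall_exists_smul_mem fun x => ?_
    obtain ⟨c, hc, hcx⟩ := Submodule.exists_smul_mem_of_span_eq_top hS.span_eq_top x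
    obtain ⟨d, hd, hdx⟩ := Submodule.exists_smul_mem_of_span_eq_top hT.span_eq_top x
    refine ⟨(c * d : R), fun h => mul_ne_zero hc hd (Subtype.ext h), ?_, ?_⟩
    · change (c * d) • x ∈ S
      rw [mul_comm, mul_smul]
      exact S.smul_mem _ hcx
    · change (c * d) • x ∈ T
      rw [mul_smul]
      exact T.smul_mem _ hdx
  one_mem := ⟨hS.one_mem, hT.one_mem⟩
  mul_mem := fun a ha b hb => ⟨hS.mul_mem a ha.1 b hb.1, hT.mul_mem a ha.2 b hb.2⟩

/-- A generator of the ideal and the power of `ϖ` with the same value differ by a unit of `R`. -/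
theorem Submodule.exists_eq_span_pow [IsPrincipalIdealRing R] {F : Type*} [Field F] [Algebra K F]
    {v : Valuation F (WithZero (Multiplicative ℤ))} (hR : Valuation.IsDenseIn R v) {ϖ : K}
    (hϖ : v (algebraMap K F ϖ) = exp (-1)) {I : Submodule R K} (hI : I ≤ 1)
    (hspan : Submodule.span K (I : Set K) = ⊤) : ∃ k : ℕ, I = Submodule.span R {ϖ ^ k} := by
  obtain ⟨a, ha⟩ := (IsPrincipalIdealRing.principal (I.comap (Algebra.linearMap R K))).principal
  have hIa : I = Submodule.span R {(a : K)} := by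
    apply le_antisymm
    · intro x hx
      obtain ⟨r, rfl⟩ := Submodule.mem_one.1 (hI hx)
      have hr : r ∈ I.comap (Algebra.linearMap R K) := hx
      rw [ha] at hr
      obtain ⟨s, rfl⟩ := Submodule.mem_span_singleton.1 hr
      exact Submodule.mem_span_singleton.2 ⟨s, rfl⟩
    · rw [Submodule.span_singleton_le_iff_mem]
      have : a ∈ I.comap (Algebra.linearMap R K) := ha ▸ Submodule.mem_span_singleton_self a
      exact this
  have ha0 : (a : K) ≠ 0 := by
    intro h
    rw [hIa, h, Submodule.span_singleton_eq_bot.2 rfl] at hspan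
    have h1 : (1 : K) ∈ Submodule.span K ((⊥ : Submodule R K) : Set K) := hspan ▸ Submodule.mem_top
    simp at h1
  obtain ⟨t, ht⟩ := Valuation.exists_map_eq_exp_neg (v := v)
    ((map_ne_zero (algebraMap K F)).2 ha0)
  have ht0 : 0 ≤ t := (Valuation.ordGE_iff_of_map_eq ht).1 ((hR.mem_iff _).2 a.2)
  have hv : v (algebraMap K F ϖ ^ t.toNat) = exp (-t) := by
    rw [Valuation.map_pow_eq hϖ, Int.toNat_of_nonneg ht0]
  have hϖ0 : ϖ ^ t.toNat ≠ 0 :=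
    pow_ne_zero _ ((map_ne_zero (algebraMap K F)).1 (Valuation.ne_zero_of_map_eq hϖ))
  have hmem : ∀ {x y : K}, y ≠ 0 → v (algebraMap K F x) = exp (-t) → v (algebraMap K F y) = exp (-t) →
      x ∈ Submodule.span R {y} := by
    intro x y hy hvx hvy
    have : x / y ∈ R := by
      rw [← hR.mem_iff, Valuation.ordGE_zero_iff, map_div₀, map_div₀, hvx, hvy, div_self exp_ne_zero]
    exact Submodule.mem_span_singleton.2 ⟨⟨_, this⟩, div_mul_cancel₀ x hy⟩
  refine ⟨t.toNat, hIa.trans (le_antisymm ?_ ?_)⟩ <;> rw [Submodule.span_singleton_le_iff_mem]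
  · exact hmem hϖ0 ht (by rwa [map_pow])
  · exact hmem ha0 (by rwa [map_pow]) ht

end LocalStructure

/-! ### The local equivalence at a closed point -/

namespace ACurve

open Valuation

variable {K : Type*} [Field K] (X : ACurve K) {A : Type*} [Ring A] [Algebra K A]

theorem eq_of_isDivisionAt [FiniteDimensional K A] [Nontrivial A] {p : X.points}
    (hp : X.IsDivisionAt A p) {M M' : Submodule (X.localRing p) A} (hM : IsLocalMaximal M)
    (hM' : IsLocalMaximal M') : M = M' := by
  obtain ⟨ϖ, hϖ⟩ := (X.localRing p).exists_map_eq_exp_neg_one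
  exact IsLocalMaximal.eq_of_division (X.localRing p).isDenseIn_adicCompletion hϖ hp hM hM'

variable [Algebra.IsCentral K A] [IsSimpleRing A]

/-- The local form of the implication from finite intersections to `𝒪 + I D₀`. -/
theorem exists_eq_one_sup_smul_inf (hA : Module.finrank K A = 4) (p : X.points)
    {S : Set (Submodule (X.localRing p) A)} (hS : S.Finite) (hne : S.Nonempty)
    (hmax : ∀ M ∈ S, IsLocalMaximal M) :
    ∃ (I : Submodule (X.localRing p) K) (M₁ M₂ : Submodule (X.localRing p) A),
      (I.FG ∧ Submodule.span K (I : Set K) = ⊤ ∧ I ≤ 1) ∧ (X.IsDivisionAt A p → I = 1) ∧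
      IsLocalMaximal M₁ ∧ IsLocalMaximal M₂ ∧ sInf S = 1 ⊔ I • (M₁ ⊓ M₂) := by
  have : FiniteDimensional K A := Module.finite_of_finrank_pos (by omega)
  by_cases hp : X.IsDivisionAt A p
  · obtain ⟨M, hM⟩ := hne
    have hSM : S = {M} := Set.eq_singleton_iff_unique_mem.2
      ⟨hM, fun N hN => X.eq_of_isDivisionAt hp (hmax N hN) (hmax M hM)⟩
    refine ⟨1, M, M, ⟨Submodule.fg_one, Submodule.span_one_eq_top, le_rfl⟩, fun _ => rfl,
      hmax M hM, hmax M hM, ?_⟩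
    rw [inf_idem, Submodule.one_sup_one_smul (hmax M hM).1.one_mem, hSM, sInf_singleton]
  · obtain ⟨ϖ, hϖ⟩ := (X.localRing p).exists_map_eq_exp_neg_one
    have hR := (X.localRing p).isDenseIn_adicCompletion
    obtain ⟨φ, hφ⟩ := exists_algHom_matrix_two (F := X.Completion p) hA hp
    obtain ⟨k, M₁, M₂, h₁, h₂, hx⟩ := hR.exists_eq_add_pow_smul φ hφ hϖ hS hne hmax
    have hϖ0 : ϖ ≠ 0 := (map_ne_zero (algebraMap K (X.Completion p))).1 (ne_zero_of_map_eq hϖ)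
    refine ⟨Submodule.span _ {ϖ ^ k}, M₁, M₂, ⟨Submodule.fg_span_singleton _, ?_, ?_⟩,
      fun h => absurd h hp, h₁, h₂, ?_⟩
    · refine Submodule.span_eq_top_of_forall_exists_smul_mem fun x => ?_
      by_cases hx0 : x = 0
      · exact ⟨1, one_ne_zero, by simp [hx0]⟩
      · refine ⟨ϖ ^ k * x⁻¹, mul_ne_zero (pow_ne_zero k hϖ0) (inv_ne_zero hx0), ?_⟩
        rw [smul_eq_mul, inv_mul_cancel_right₀ hx0]
        exact Submodule.mem_span_singleton_self _
    · rw [Submodule.span_singleton_le_iff_mem]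
      refine Submodule.mem_one.2 ⟨⟨ϖ ^ k, ?_⟩, rfl⟩
      rw [← hR.mem_iff, map_pow, ordGE_iff_of_map_eq (map_pow_eq hϖ k)]
      omega
    · ext x
      rw [Submodule.mem_sInf, hx, Submodule.mem_one_sup_span_singleton_smul]

/-- The local form of the implication from `𝒪 + I D₀` to intersections of three maximal orders. -/
theorem exists_inf_inf_eq_one_sup_smul_inf (hA : Module.finrank K A = 4) (p : X.points)
    {I : Submodule (X.localRing p) K} (hI : I ≤ 1) (hspan : Submodule.span K (I : Set K) = ⊤)
    (hdiv : X.IsDivisionAt A p → I = 1) {M₁ M₂ : Submodule (X.localRing p) A}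
    (h₁ : IsLocalMaximal M₁) (h₂ : IsLocalMaximal M₂) :
    ∃ N₁ N₂ N₃ : Submodule (X.localRing p) A, IsLocalMaximal N₁ ∧ IsLocalMaximal N₂ ∧
      IsLocalMaximal N₃ ∧ 1 ⊔ I • (M₁ ⊓ M₂) = N₁ ⊓ N₂ ⊓ N₃ := by
  have : FiniteDimensional K A := Module.finite_of_finrank_pos (by omega)
  by_cases hp : X.IsDivisionAt A p
  · refine ⟨M₁, M₂, M₂, h₁, h₂, h₂, ?_⟩
    rw [hdiv hp, Submodule.one_sup_one_smul (Submodule.mem_inf.2 ⟨h₁.1.one_mem, h₂.1.one_mem⟩), inf_assoc, inf_idem]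
  · obtain ⟨ϖ, hϖ⟩ := (X.localRing p).exists_map_eq_exp_neg_one
    have hR := (X.localRing p).isDenseIn_adicCompletion
    obtain ⟨φ, hφ⟩ := exists_algHom_matrix_two (F := X.Completion p) hA hp
    obtain ⟨k, rfl⟩ := Submodule.exists_eq_span_pow hR hϖ hI hspan
    obtain ⟨N₁, N₂, N₃, h1, h2, h3, hx⟩ := hR.exists_three φ hφ hϖ h₁ h₂ k
    refine ⟨N₁, N₂, N₃, h1, h2, h3, ?_⟩
    ext x
    rw [hx, Submodule.mem_one_sup_span_singleton_smul]

end ACurve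

end DiscreteValuations

/-! ### Gluing of stalks -/

namespace ACurve

variable {K : Type*} [Field K] {X : ACurve K}

/-- The two spans agree wherever the change-of-basis matrix and its inverse have integral entries,
which excludes only finitely many points. -/
theorem finite_span_ne_span (hK : IsGlobalField K) {V : Type*} [AddCommGroup V] [Module K V]
    {n m : ℕ} (b : Module.Basis (Fin n) K V) (b' : Module.Basis (Fin m) K V) :
    {p : X.points | Submodule.span (X.localRing p) (Set.range b) ≠
      Submodule.span (X.localRing p) (Set.range b')}.Finite := by
  have key : ∀ {n m : ℕ} (b : Module.Basis (Fin n) K V) (b' : Module.Basis (Fin m) K V),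
      {p : X.points | ¬ Submodule.span (X.localRing p) (Set.range b) ≤
        Submodule.span (X.localRing p) (Set.range b')}.Finite := by
    intro n m b b'
    refine (Set.finite_iUnion fun i => Set.finite_iUnion fun j =>
      finite_notMem hK X (b'.repr (b i) j)).subset fun p hp => ?_
    by_contra h
    simp only [Set.mem_iUnion, Set.mem_ofPred_eq, not_exists, not_not] at h
    refine hp (Submodule.span_le.2 ?_)
    rintro _ ⟨i, rfl⟩
    rw [SetLike.mem_coe, ← b'.sum_repr (b i)]
    refine Submodule.sum_mem _ fun j _ => ?_
    exact Submodule.smul_mem _ (⟨_, h i j⟩ : X.localRing p) (Submodule.subset_span ⟨j, rfl⟩)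
  refine ((key b b').union (key b' b)).subset fun p hp => ?_
  by_contra h
  simp only [Set.mem_union, Set.mem_ofPred_eq, not_or, not_not] at h
  exact hp (le_antisymm h.1 h.2)

theorem Lattice.finite_stalk_ne (hK : IsGlobalField K) {V : Type*} [AddCommGroup V] [Module K V]
    (L L' : X.Lattice V) : {p : X.points | L.stalk p ≠ L'.stalk p}.Finite := by
  obtain ⟨n, b, hb⟩ := L.coherent
  obtain ⟨m, b', hb'⟩ := L'.coherent
  refine ((hb.union hb').union (finite_span_ne_span hK b b')).subset fun p hp => ?_
  by_contra h
  simp only [Set.mem_union, Set.mem_ofPred_eq, not_or, not_not] at h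
  exact hp (h.1.1.trans (h.2.trans h.1.2.symm))

/-- The lattice with prescribed stalks that differ from those of a given lattice at finitely many
closed points. -/
def Lattice.ofStalks {V : Type*} [AddCommGroup V] [Module K V] (L : X.Lattice V)
    (T : ∀ p : X.points, Submodule (X.localRing p) V) (hfg : ∀ p, (T p).FG)
    (hspan : ∀ p, Submodule.span K (T p : Set V) = ⊤)
    (hfin : {p | T p ≠ L.stalk p}.Finite) : X.Lattice V where
  stalk := T
  fg_stalk := hfg
  span_stalk := hspan
  coherent := by
    obtain ⟨n, b, hb⟩ := L.coherent
    refine ⟨n, b, (hfin.union hb).subset fun p hp => ?_⟩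
    by_contra h
    simp only [Set.mem_union, Set.mem_ofPred_eq, not_or, not_not] at h
    exact hp (h.1.trans h.2)

/-- The structure sheaf as a lattice in `K`. -/
def unitLattice (X : ACurve K) : X.Lattice K where
  stalk _ := 1
  fg_stalk _ := Submodule.fg_one
  span_stalk _ := Submodule.span_one_eq_top
  coherent := by
    refine ⟨1, Module.Basis.singleton (Fin 1) K, Set.finite_empty.subset fun p hp => hp ?_⟩
    rw [Submodule.one_eq_span]
    congr 1
    ext x
    simp

namespace Order

variable {A : Type*} [Ring A] [Algebra K A]

theorem isLocalOrder (D : X.Order A) (p : X.points) : IsLocalOrder (D.stalk p) where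
  fg := D.fg_stalk p
  span_eq_top := D.span_stalk p
  one_mem := D.one_mem p
  mul_mem := D.mul_mem p

theorem ext_stalk {D E : X.Order A} (h : ∀ p, D.stalk p = E.stalk p) : D = E := by
  obtain ⟨⟨s, _, _, _⟩, _, _⟩ := D
  obtain ⟨⟨t, _, _, _⟩, _, _⟩ := E
  obtain rfl : s = t := funext h
  rfl

/-- The order with prescribed stalks that differ from those of a given order at finitely many
closed points. -/
def ofStalks (D : X.Order A) (T : ∀ p : X.points, Submodule (X.localRing p) A)
    (hT : ∀ p, IsLocalOrder (T p)) (hfin : {p | T p ≠ D.stalk p}.Finite) : X.Order A where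
  toLattice := D.toLattice.ofStalks T (fun p => (hT p).fg) (fun p => (hT p).span_eq_top) hfin
  one_mem p := (hT p).one_mem
  mul_mem p := (hT p).mul_mem

/-- An order strictly larger than `D.stalk p` at one point can be glued to `D` at all other points,
so maximality can be tested stalkwise. -/
theorem isMaximal_iff {D : X.Order A} : D.IsMaximal ↔ ∀ p, IsLocalMaximal (D.stalk p) := by
  classical
  constructor
  · refine fun h p => ⟨D.isLocalOrder p, fun T hT hle => ?_⟩
    let E : X.Order A := D.ofStalks (Function.update D.stalk p T)
      (fun q => by
        rcases eq_or_ne q p with rfl | hq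
        · rwa [Function.update_self]
        · rw [Function.update_of_ne hq]
          exact D.isLocalOrder q)
      ((Set.finite_singleton p).subset fun q hq => by
        by_contra hqp
        exact hq (Function.update_of_ne hqp _ _))
    have hE : E = D := h E fun q => by
      change D.stalk q ≤ Function.update D.stalk p T q
      rcases eq_or_ne q p with rfl | hq
      · rwa [Function.update_self]
      · rw [Function.update_of_ne hq]
    have hp : Function.update D.stalk p T p = D.stalk p := congrArg (fun E => E.stalk p) hE
    rwa [Function.update_self] at hp
  · exact fun h E hE => ext_stalk fun p => (h p).2 _ (E.isLocalOrder p) (hE p)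

variable [Algebra.IsCentral K A] [IsSimpleRing A]

theorem exists_three_of_eqUnitAddIdealMul (hK : IsGlobalField K) (hA : Module.finrank K A = 4)
    {D D₀ : X.Order A} {I : X.IntegralIdeal} (h₀ : D₀.IsEichler)
    (hI : ∀ p, X.IsDivisionAt A p → I.stalk p = 1) (hD : D.EqUnitAddIdealMul I D₀) :
    ∃ M₁ M₂ M₃ : X.Order A, M₁.IsMaximal ∧ M₂.IsMaximal ∧ M₃.IsMaximal ∧
      ∀ p, D.stalk p = M₁.stalk p ⊓ M₂.stalk p ⊓ M₃.stalk p := by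
  obtain ⟨N₁, N₂, hN₁, hN₂, hN⟩ := h₀
  -- The last clause fixes the choice wherever `I` is trivial, hence at almost all points. Without
  -- it the chosen stalks need not form a lattice.
  have hloc : ∀ p, ∃ T₁ T₂ T₃ : Submodule (X.localRing p) A, IsLocalMaximal T₁ ∧
      IsLocalMaximal T₂ ∧ IsLocalMaximal T₃ ∧ D.stalk p = T₁ ⊓ T₂ ⊓ T₃ ∧
      (I.stalk p = 1 → T₁ = N₁.stalk p ∧ T₂ = N₂.stalk p ∧ T₃ = N₂.stalk p) := by
    intro p
    have h₁ := isMaximal_iff.1 hN₁ p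
    have h₂ := isMaximal_iff.1 hN₂ p
    by_cases hp : I.stalk p = 1
    · refine ⟨_, _, _, h₁, h₂, h₂, ?_, fun _ => ⟨rfl, rfl, rfl⟩⟩
      rw [hD p, hp, Submodule.one_sup_one_smul (D₀.one_mem p), hN p, inf_assoc, inf_idem]
    · obtain ⟨T₁, T₂, T₃, t₁, t₂, t₃, h⟩ :=
        X.exists_inf_inf_eq_one_sup_smul_inf hA p (I.integral p) (I.span_stalk p) (hI p) h₁ h₂
      exact ⟨T₁, T₂, T₃, t₁, t₂, t₃, by rw [hD p, hN p, h], fun h => absurd h hp⟩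
  choose T₁ T₂ T₃ t₁ t₂ t₃ hT hT1 using hloc
  have hfin : {p | I.stalk p ≠ 1}.Finite := I.toLattice.finite_stalk_ne hK X.unitLattice
  refine ⟨N₁.ofStalks T₁ (fun p => (t₁ p).1) (hfin.subset fun p hp h => hp (hT1 p h).1),
    N₂.ofStalks T₂ (fun p => (t₂ p).1) (hfin.subset fun p hp h => hp (hT1 p h).2.1),
    N₂.ofStalks T₃ (fun p => (t₃ p).1) (hfin.subset fun p hp h => hp (hT1 p h).2.2),
    isMaximal_iff.2 t₁, isMaximal_iff.2 t₂, isMaximal_iff.2 t₃, hT⟩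

theorem exists_eqUnitAddIdealMul_of_iInf (hK : IsGlobalField K) (hA : Module.finrank K A = 4)
    {D : X.Order A} {F : Set (X.Order A)} (hF : F.Finite) (hne : F.Nonempty)
    (hmax : ∀ M ∈ F, M.IsMaximal) (hD : ∀ p, D.stalk p = ⨅ M ∈ F, M.stalk p) :
    ∃ (I : X.IntegralIdeal) (D₀ : X.Order A), D₀.IsEichler ∧
      (∀ p, X.IsDivisionAt A p → I.stalk p = 1) ∧ D.EqUnitAddIdealMul I D₀ := by
  obtain ⟨M₀, hM₀⟩ := hne
  -- Where all members of the family have the same stalk, which is almost everywhere, the trivial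
  -- data are prescribed so that the choices glue.
  have hloc : ∀ p, ∃ (J : Submodule (X.localRing p) K) (T₁ T₂ : Submodule (X.localRing p) A),
      (J.FG ∧ Submodule.span K (J : Set K) = ⊤ ∧ J ≤ 1) ∧ (X.IsDivisionAt A p → J = 1) ∧
      IsLocalMaximal T₁ ∧ IsLocalMaximal T₂ ∧ D.stalk p = 1 ⊔ J • (T₁ ⊓ T₂) ∧
      ((∀ M ∈ F, M.stalk p = M₀.stalk p) →
        J = 1 ∧ T₁ = M₀.stalk p ∧ T₂ = M₀.stalk p) := by
    intro p
    by_cases hp : ∀ M ∈ F, M.stalk p = M₀.stalk p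
    · have h₀ := isMaximal_iff.1 (hmax M₀ hM₀) p
      refine ⟨1, _, _, ⟨Submodule.fg_one, Submodule.span_one_eq_top, le_rfl⟩, fun _ => rfl, h₀, h₀,
        ?_, fun _ => ⟨rfl, rfl, rfl⟩⟩
      rw [inf_idem, Submodule.one_sup_one_smul (M₀.one_mem p), hD p]
      exact le_antisymm (iInf₂_le M₀ hM₀) (le_iInf₂ fun M hM => (hp M hM).ge)
    · obtain ⟨J, T₁, T₂, hJ, hJ1, t₁, t₂, h⟩ := X.exists_eq_one_sup_smul_inf hA p
        (hF.image fun M => M.stalk p) ⟨_, M₀, hM₀, rfl⟩ (by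
          rintro _ ⟨M, hM, rfl⟩
          exact isMaximal_iff.1 (hmax M hM) p)
      exact ⟨J, T₁, T₂, hJ, hJ1, t₁, t₂, by rw [hD p, ← h, sInf_image], fun h => absurd h hp⟩
  choose J T₁ T₂ hJ hJ1 t₁ t₂ hT hgood using hloc
  have hfin : {p | ¬ ∀ M ∈ F, M.stalk p = M₀.stalk p}.Finite := by
    refine (hF.biUnion fun M _ => M.toLattice.finite_stalk_ne hK M₀.toLattice).subset fun p hp => ?_
    simpa using hp
  have ht₁ : {p | T₁ p ≠ M₀.stalk p}.Finite := hfin.subset fun p hp h => hp (hgood p h).2.1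
  have ht₂ : {p | T₂ p ≠ M₀.stalk p}.Finite := hfin.subset fun p hp h => hp (hgood p h).2.2
  refine ⟨⟨X.unitLattice.ofStalks J (fun p => (hJ p).1) (fun p => (hJ p).2.1)
      (hfin.subset fun p hp h => hp (hgood p h).1), fun p => (hJ p).2.2⟩,
    M₀.ofStalks (fun p => T₁ p ⊓ T₂ p) (fun p => (t₁ p).1.inf (t₂ p).1)
      (hfin.subset fun p hp h => hp ?_),
    ⟨M₀.ofStalks T₁ (fun p => (t₁ p).1) ht₁, M₀.ofStalks T₂ (fun p => (t₂ p).1) ht₂,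
      isMaximal_iff.2 t₁, isMaximal_iff.2 t₂, fun p => rfl⟩, hJ1, hT⟩
  rw [(hgood p h).2.1, (hgood p h).2.2, inf_idem]

end Order

end ACurve

/-! ### The equivalence -/

theorem theorem1p2 {K : Type*} [Field K] (hK : IsGlobalField K) (X : ACurve K)
    {A : Type*} [Ring A] [Algebra K A] [Algebra.IsCentral K A] [IsSimpleRing A]
    (hA : Module.finrank K A = 4) (D : X.Order A) :
    List.TFAE [
      ∃ (I : X.IntegralIdeal) (D₀ : X.Order A), D₀.IsEichler ∧
        (∀ p, X.IsDivisionAt A p → I.stalk p = 1) ∧ D.EqUnitAddIdealMul I D₀,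
      ∃ F : Set (X.Order A), F.Finite ∧ F.Nonempty ∧ (∀ M ∈ F, M.IsMaximal) ∧
        ∀ p, D.stalk p = ⨅ M ∈ F, M.stalk p,
      ∃ M₁ M₂ M₃ : X.Order A, M₁.IsMaximal ∧ M₂.IsMaximal ∧ M₃.IsMaximal ∧
        ∀ p, D.stalk p = M₁.stalk p ⊓ M₂.stalk p ⊓ M₃.stalk p] := by
  tfae_have 1 → 3 := by
    rintro ⟨I, D₀, h₀, hI, hD⟩
    exact ACurve.Order.exists_three_of_eqUnitAddIdealMul hK hA h₀ hI hD
  tfae_have 3 → 2 := by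
    rintro ⟨M₁, M₂, M₃, h₁, h₂, h₃, hD⟩
    refine ⟨{M₁, M₂, M₃}, Set.toFinite _, ⟨M₁, by simp⟩, ?_, fun p => ?_⟩
    · rintro M (rfl | rfl | rfl) <;> assumption
    · rw [hD p, iInf_insert, iInf_insert, iInf_singleton, inf_assoc]
  tfae_have 2 → 1 := by
    rintro ⟨F, hF, hne, hmax, hD⟩
    exact ACurve.Order.exists_eqUnitAddIdealMul_of_iInf hK hA hF hne hmax hD
  tfae_finish
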